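/- **Model.** A network is a connected undirected graph $G=(V,E)$ with $n=|V|$ vertices and diameter $D$, distinct numerical identifiers, and at each vertex a numbering of its incident edges. Each edge has a weight $\omega(e)\in\mathbb N$, and a candidate set $T\subseteq E$ is given. A vertex initially knows $n$, its identifier, and the weight and candidate mark of each incident edge. A deterministic distributed algorithm is a local program run by all vertices in synchronous rounds; in every round a vertex may send over each incident edge a message of at most $B$ bits, where $B\ge1$ (except in part 6, where only $B=O(\log n)$ is assumed, and part 4, where messages may have any length). Either all vertices start simultaneously, or only one source vertex is awake at the start and every other vertex wakes up when it first receives a message; all the bounds below hold in both settings. The algorithm solves *MST verification* on an instance if eventually every vertex permanently outputs $1$ if $T$ is (the edge set of) a minimum-weight spanning tree of $(G,\omega)$ and $0$ otherwise; its time on the instance is the number of rounds until then. Saying that an algorithm *needs* a certain time on a class of instances means: if it solves every instance of the class, then on some instance of the class its time is at least that large. In parts 3, 5, 6 identifiers and weights are only required to be at most $n^{\kappa}$, for an arbitrary fixed integer $\kappa\ge 1$; in part 4 weights are only required to be at most $n^{\kappa}$, for an arbitrary fixed integer $\kappa\ge0$. The constants in all bounds do not depend on the algorithm, on $\kappa$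 or on the start setting; those in part 6 may depend on the constant in $B=O(\log n)$. **The graphs $F^2_m$ and the family $\mathcal J^2_m$** ($m\ge1$). $F^2_m$ consists of a *highway*, the path $h_0,h_m,h_{2m},\dots,h_{m^2}$; of $m^2$ disjoint paths $v^j_0,v^j_1,\dots,v^j_{m^2}$ $(1\le j\le m^2)$; and of the *spokes* $\{h_{im},v^j_{im}\}$ for $0\le i\le m$, $1\le j\le m^2$. The family $\mathcal J^2_m$ consists of the $2^{m^2}$ weighted graphs $(F^2_m,\omega)$ in which highway and path edges have weight $0$, spokes with $0<i<m$ have weight $4$, spokes with $i=m$ have weight $2$, and each spoke with $i=0$ has weight $1$ or $3$. **Theorem.** 1. $F^2_m$ is connected, has $\Theta(m^4)$ vertices and diameter $\Theta(m)$. 2. For all $m\ge1$ and $B\ge 1$, every algorithm for MST verification on the graphs of $\mathcal J^2_m$ (with all candidate sets) needs $\Omega(m^2/B)$ rounds. This holds for every fixed choice of the identifiers, of the edge numberings and of the set of initially awake vertices. 3. There is a constant $C$ such that for all sufficiently large $n$ every MST verification algorithm needs $\Omega(\sqrt n/B)$ rounds on $n$-vertex graphs of diameter at most $C n^{1/4}$.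 4. On every network of diameter $D\ge2$ (with fixed identifiers, edge numberings and set of initially awake vertices, and with weights and candidate varying), every MST verification algorithm needs $\Omega(D)$ rounds. 5. There is a constant $C>0$ such that for all $n$, $D$ with $C n^{1/4}\le D\le n-1$, every MST verification algorithm needs $\Omega(\sqrt n/B+D)$ rounds on $n$-vertex graphs of diameter $D$. 6. Consequently, with messages of $O(\log n)$ bits, and for all such $n$ and $D$ (with an absolute constant $C>0$), every MST verification algorithm needs $\Omega\big((\sqrt n+D)/\log n\big)=\tilde\Omega(\sqrt n+D)$ rounds on $n$-vertex graphs of diameter $D$. -/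

import Mathlib

universe u

namespace Congest

/-- A communication network on the vertex set `V`: an undirected graph, distinct identifiers, and
at every vertex a numbering `0, …, deg v - 1` of the incident edges ("ports"). -/
structure Network (V : Type) where
  graph : SimpleGraph V
  ident : V → ℕ
  ident_injective : Function.Injective ident
  deg : V → ℕ
  port : ∀ v, Fin (deg v) ≃ graph.neighborSet v

/-- The neighbour of `v` behind port `p`. -/
def Network.nbr {V : Type} (N : Network V) (v : V) (p : Fin (N.deg v)) : V :=
  (N.port v p : V)

/-- The number that the edge behind port `p` of `v` has at its other end. -/
def Network.backPort {V : Type} (N : Network V) (v : V) (p : Fin (N.deg v)) :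
    Fin (N.deg (N.nbr v p)) :=
  (N.port (N.nbr v p)).symm ⟨v, SimpleGraph.Adj.symm (N.port v p).2⟩

/-- `T` is (the edge set of) a spanning tree of `G`. -/
def IsSpanningTree {V : Type} (G : SimpleGraph V) (T : Finset (Sym2 V)) : Prop :=
  (T : Set (Sym2 V)) ⊆ G.edgeSet ∧ (SimpleGraph.fromEdgeSet (T : Set (Sym2 V))).IsTree

/-- `T` is (the edge set of) a minimum-weight spanning tree of `(G, ω)`. -/
def IsMST {V : Type} (G : SimpleGraph V) (ω : Sym2 V → ℕ) (T : Finset (Sym2 V)) : Prop :=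
  IsSpanningTree G T ∧ ∀ T', IsSpanningTree G T' → ∑ e ∈ T, ω e ≤ ∑ e ∈ T', ω e

/-- An instance of distributed MST verification: a network, edge weights (only the values on edges
matter), a candidate set of edges, and the set of vertices that are awake when the execution
starts. -/
structure Instance (V : Type) where
  net : Network V
  weight : Sym2 V → ℕ
  cand : Finset (Sym2 V)
  cand_subset : (cand : Set (Sym2 V)) ⊆ net.graph.edgeSet
  awake : Set V

/-- What a vertex knows about its incident edges: for every port, the weight of the edge and
whether the edge is in the candidate. -/
structure LocalInput where
  deg : ℕ
  weight : Fin deg → ℕ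
  mark : Fin deg → Bool

open Classical in
/-- The local input of the vertex `v`. -/
noncomputable def Instance.localInput {V : Type} (I : Instance V) (v : V) : LocalInput where
  deg := I.net.deg v
  weight p := I.weight s(v, I.net.nbr v p)
  mark p := decide (s(v, I.net.nbr v p) ∈ I.cand)

/-- A deterministic distributed algorithm: one local program run by all vertices.
* `start n i t x` is the state in which a vertex begins, where `n` is the number of vertices of the
  network, `i` its identifier, `t` the time at which it wakes up (`0` if it is awake from the
  start) and `x` its local input;
* `send σ p` is the bit string sent over port `p` in state `σ` (`none`: no message is sent);
* `recv σ f` is the state after receiving, in state `σ`, the messages `f p` over the ports `p`;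
* `output σ` is the value of the output variable (`none`: not assigned). -/
structure Algorithm where
  State : Type u
  start : ℕ → ℕ → ℕ → LocalInput → State
  send : State → ℕ → Option (List Bool)
  recv : State → (ℕ → Option (List Bool)) → State
  output : State → Option Bool

section Execution

variable {V : Type} [Fintype V] (A : Algorithm.{u}) (I : Instance V)

/-- The state in which `v` begins if it wakes up at time `t`. -/
noncomputable def Algorithm.startState (t : ℕ) (v : V) : A.State :=
  A.start (Fintype.card V) (I.net.ident v) t (I.localInput v)

/-- The message that `v` sends over its port `p` if the vertices are in the states `c`;
sleeping vertices (state `none`) send nothing. -/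
def Algorithm.sent {V : Type} (A : Algorithm.{u}) (c : V → Option A.State) (v : V) (p : ℕ) :
    Option (List Bool) :=
  (c v).bind fun σ => A.send σ p

/-- The messages that reach `v`, by port, if they are sent from the states `c`. -/
def Algorithm.inbox {V : Type} (A : Algorithm.{u}) (N : Network V) (c : V → Option A.State)
    (v : V) (p : ℕ) : Option (List Bool) :=
  if hp : p < N.deg v then A.sent c (N.nbr v ⟨p, hp⟩) (N.backPort v ⟨p, hp⟩) else none

open Classical in
/-- The states after `t` rounds of the synchronous execution; `none` means asleep. A sleeping
vertex wakes up when it receives a message. -/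
noncomputable def Algorithm.config : ℕ → V → Option A.State
  | 0, v => if v ∈ I.awake then some (A.startState I 0 v) else none
  | t + 1, v =>
    match Algorithm.config t v with
    | some σ => some (A.recv σ (A.inbox I.net (Algorithm.config t) v))
    | none =>
      if ∃ p, A.inbox I.net (Algorithm.config t) v p ≠ none then
        some (A.recv (A.startState I (t + 1) v) (A.inbox I.net (Algorithm.config t) v))
      else none

open Classical in
/-- From time `T` on, the output variable of every vertex says whether the candidate is an MST. -/
def Algorithm.SolvesBy (T : ℕ) : Prop :=
  ∀ t ≥ T, ∀ v,
    (A.config I t v).bind A.output = some (decide (IsMST I.net.graph I.weight I.cand))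

/-- Every message of the execution has at most `B` bits. -/
def Algorithm.MessagesBounded (B : ℕ) : Prop :=
  ∀ t v p, p < I.net.deg v → ∀ msg, A.sent (A.config I t) v p = some msg → msg.length ≤ B

/-- The algorithm solves the instance, in the model with messages of at most `B` bits. -/
def Algorithm.Verifies (B : ℕ) : Prop :=
  (∃ T, A.SolvesBy I T) ∧ A.MessagesBounded I B

/-- The algorithm needs at least `x` rounds on the instance. -/
def Algorithm.NeedsTime (x : ℝ) : Prop :=
  ∀ T : ℕ, A.SolvesBy I T → x ≤ T

end Execution

/-- The two standard conventions on how an execution starts. -/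
inductive StartMode
  | simultaneous
  | singleSource

def StartMode.Allows {V : Type} : StartMode → Set V → Prop
  | simultaneous, S => S = Set.univ
  | singleSource, S => ∃ s, S = {s}

/-- The legal `n`-vertex instances: connected graphs, identifiers and edge weights at most
`n ^ κ`, and a start as prescribed by `mode`. -/
def Instance.Legal {V : Type} [Fintype V] (I : Instance V) (mode : StartMode) (κ n : ℕ) : Prop :=
  Fintype.card V = n ∧ I.net.graph.Connected ∧ (∀ v, I.net.ident v ≤ n ^ κ) ∧
    (∀ e ∈ I.net.graph.edgeSet, I.weight e ≤ n ^ κ) ∧ mode.Allows I.awake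

/-- Vertices of the graph `F²ₘ`: `Sum.inl a` is the highway vertex `h_{am}`, and `Sum.inr (j, x)`
is the vertex `v_x` of the `j`-th path. -/
abbrev FVert (m : ℕ) : Type := Fin (m + 1) ⊕ (Fin (m ^ 2) × Fin (m ^ 2 + 1))

/-- The edges of `F²ₘ`, in one orientation: highway edges, path edges, spokes. -/
def FRel (m : ℕ) : FVert m → FVert m → Prop
  | Sum.inl a, Sum.inl b => (a : ℕ) + 1 = b
  | Sum.inr (j, x), Sum.inr (k, y) => j = k ∧ (x : ℕ) + 1 = y
  | Sum.inl a, Sum.inr (_, x) => (x : ℕ) = a * m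
  | Sum.inr _, Sum.inl _ => False

/-- The graph `F²ₘ`. -/
def FGraph (m : ℕ) : SimpleGraph (FVert m) := SimpleGraph.fromRel (FRel m)

/-- The weight functions `ω_γ` of the family `𝒥²ₘ`. -/
structure IsJWeight (m : ℕ) (ω : Sym2 (FVert m) → ℕ) : Prop where
  highway : ∀ a b : Fin (m + 1), (a : ℕ) + 1 = b → ω s(Sum.inl a, Sum.inl b) = 0
  path : ∀ (j : Fin (m ^ 2)) (x y : Fin (m ^ 2 + 1)), (x : ℕ) + 1 = y →
    ω s(Sum.inr (j, x), Sum.inr (j, y)) = 0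
  innerSpoke : ∀ (a : Fin (m + 1)) (j : Fin (m ^ 2)) (x : Fin (m ^ 2 + 1)), (x : ℕ) = a * m →
    (a : ℕ) ≠ 0 → (a : ℕ) ≠ m → ω s(Sum.inl a, Sum.inr (j, x)) = 4
  lastSpoke : ∀ (a : Fin (m + 1)) (j : Fin (m ^ 2)) (x : Fin (m ^ 2 + 1)), (x : ℕ) = a * m →
    (a : ℕ) = m → ω s(Sum.inl a, Sum.inr (j, x)) = 2
  firstSpoke : ∀ (a : Fin (m + 1)) (j : Fin (m ^ 2)) (x : Fin (m ^ 2 + 1)), (x : ℕ) = a * m →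
    (a : ℕ) = 0 → ω s(Sum.inl a, Sum.inr (j, x)) = 1 ∨ ω s(Sum.inl a, Sum.inr (j, x)) = 3

end Congest

open Congest

/-! The bound in `m` is a fooling-set argument for equality. A bit vector `x` sits at the first
spokes of `FGraph m` (weight 1 and marked, or weight 3 and unmarked), a bit vector `y` at the last
spokes (marked where the bit is not set). If `x = y`, every path hangs on the highway by exactly one
spoke, its cheapest, and the candidate is an MST (`isMST_extCand`). If `x ≠ y`, then for one of the
pairs `(x, y)`, `(y, x)` some path has no marked spoke, so the candidate is disconnected
(`not_isMST_or`).

Knowledge of the two ends can only meet quickly through the highway. Let the regions "position `>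
t`" and "position `< m² - t`" shrink as the rounds pass: path edges change the position by one and
spokes not at all, so per round only one highway edge brings outside information into each region
(`narrowCut_extension`). Two diagonal inputs with equal messages on these edges can be spliced, and
the mixed input then gets the answer of a diagonal one (`NarrowCut.card_le`). Hence `m² ≤ 2T(B +
1)`.

The bound in `D` compares a spanning tree with the same tree minus an edge at one end of a diameter;
the other end cannot see the difference in time (`exists_needsTime_diam`).

To prescribe `n` and `D` exactly, a path and leaves are attached to the first highway vertex
(`tailGraph_diam`). The attached part has weight 0 and counts as position 0, so the cut argument
survives; `RootedExtension` records what this needs. For the sum, whichever of the two terms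
dominates selects the instance (`exists_needsTime_sqrt_add_diam`). -/

namespace Congest

/-! ### Locality of one round of the execution -/

section Locality

variable {V : Type} {A : Algorithm.{u}} {N : Network V}

theorem Instance.localInput_congr {I J : Instance V} {v : V} (hI : I.net = N) (hJ : J.net = N)
    (h : ∀ w, N.graph.Adj v w →
      I.weight s(v, w) = J.weight s(v, w) ∧ (s(v, w) ∈ I.cand ↔ s(v, w) ∈ J.cand)) :
    I.localInput v = J.localInput v := by
  obtain ⟨M, ω, T, hT, S⟩ := I
  obtain ⟨M', ω', T', hT', S'⟩ := J
  obtain rfl : M = N := hI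
  obtain rfl : M' = M := hJ
  have key := fun p : Fin (M'.deg v) => h (M'.nbr v p) (M'.port v p).2
  simp only [Instance.localInput, LocalInput.mk.injEq, heq_eq_eq, true_and]
  exact ⟨funext fun p => (key p).1, funext fun p => decide_eq_decide.2 (key p).2⟩

/-- The message that reaches `v` from `w` if messages are sent from the states `c`. -/
noncomputable def Algorithm.arrival (A : Algorithm.{u}) (N : Network V) (c : V → Option A.State)
    (v w : V) : Option (List Bool) :=
  open Classical in
  if h : N.graph.Adj v w then A.inbox N c v ((N.port v).symm ⟨w, h⟩) else none

/-- Indexing messages by the sending vertex instead of by the port makes this visible: a message is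
a function of its sender's state alone. -/
theorem Algorithm.arrival_congr {c c' : V → Option A.State} {v w : V} (h : c w = c' w) :
    A.arrival N c v w = A.arrival N c' v w := by
  unfold Algorithm.arrival
  split_ifs with hvw
  · have hw : N.nbr v ((N.port v).symm ⟨w, hvw⟩) = w := by simp [Network.nbr]
    simp only [Algorithm.inbox, Algorithm.sent, Fin.is_lt, dite_true, Fin.eta]
    rw [show c (N.nbr v ((N.port v).symm ⟨w, hvw⟩)) = c' (N.nbr v ((N.port v).symm ⟨w, hvw⟩)) by
      rw [hw, h]]
  · rfl

theorem Algorithm.inbox_congr {c c' : V → Option A.State} {v : V}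
    (h : ∀ w, N.graph.Adj v w → A.arrival N c v w = A.arrival N c' v w) :
    A.inbox N c v = A.inbox N c' v := by
  funext p
  by_cases hp : p < N.deg v
  · have hadj : N.graph.Adj v (N.nbr v ⟨p, hp⟩) := (N.port v ⟨p, hp⟩).2
    have hq : (N.port v).symm ⟨N.nbr v ⟨p, hp⟩, hadj⟩ = ⟨p, hp⟩ := by simp [Network.nbr]
    have := h _ hadj
    simpa only [Algorithm.arrival, hadj, dite_true, hq] using this
  · simp [Algorithm.inbox, hp]

variable [Fintype V]

theorem Algorithm.config_zero_congr {I J : Instance V} (hI : I.net = N) (hJ : J.net = N) {v : V}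
    (haw : I.awake = J.awake) (hin : I.localInput v = J.localInput v) :
    A.config I 0 v = A.config J 0 v := by
  simp only [Algorithm.config, Algorithm.startState, hI, hJ, hin]
  rw [haw]

theorem Algorithm.config_succ_congr {I J : Instance V} (hI : I.net = N) (hJ : J.net = N) {t : ℕ}
    {v : V} (hin : I.localInput v = J.localInput v) (hc : A.config I t v = A.config J t v)
    (h : ∀ w, N.graph.Adj v w →
      A.arrival N (A.config I t) v w = A.arrival N (A.config J t) v w) :
    A.config I (t + 1) v = A.config J (t + 1) v := by
  have hbox := Algorithm.inbox_congr h
  simp only [Algorithm.config, Algorithm.startState, hI, hJ, hin, hc, hbox]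
  rw [hI, hJ, hbox]

theorem Algorithm.length_arrival_le {I : Instance V} (hI : I.net = N) {B : ℕ}
    (hB : A.MessagesBounded I B) {t : ℕ} {v w : V} {msg : List Bool}
    (h : A.arrival N (A.config I t) v w = some msg) : msg.length ≤ B := by
  subst hI
  unfold Algorithm.arrival at h
  split_ifs at h with hvw
  simp only [Algorithm.inbox, Fin.is_lt, dite_true, Fin.eta] at h
  exact hB t _ _ (Fin.is_lt _) msg h

theorem Algorithm.SolvesBy.mono {I : Instance V} {S T : ℕ} (h : A.SolvesBy I S) (hST : S ≤ T) :
    A.SolvesBy I T :=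
  fun t ht => h t (hST.trans ht)

/-- Two instances that some vertex cannot tell apart up to time `T` have the same answer if both
are solved by then. -/
theorem Algorithm.SolvesBy.isMST_iff {I J : Instance V} {T : ℕ} (hI : A.SolvesBy I T)
    (hJ : A.SolvesBy J T) {v : V} (h : A.config I T v = A.config J T v) :
    IsMST I.net.graph I.weight I.cand ↔ IsMST J.net.graph J.weight J.cand := by
  have h1 := hI T le_rfl v
  have h2 := hJ T le_rfl v
  rw [h, h2] at h1
  simpa using h1.symm

/-- If every member of a family is solved before time `x`, then a common time before `x` works for
all of them. -/
theorem Algorithm.exists_solvesBy_of_forall_not_needsTime {ι : Type*} [Nonempty ι]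
    {I : ι → Instance V} {x : ℝ} (h : ∀ i, ¬ A.NeedsTime (I i) x) :
    ∃ T : ℕ, (T : ℝ) < x ∧ ∀ i, A.SolvesBy (I i) T := by
  simp only [Algorithm.NeedsTime, not_forall, not_le] at h
  choose t ht htx using h
  have hx : 0 < x := (Nat.cast_nonneg _).trans_lt (htx (Classical.arbitrary ι))
  have hpos : 0 < ⌈x⌉₊ := Nat.ceil_pos.2 hx
  -- The largest natural number below `x`; it bounds all the individual solution times, which are
  -- natural numbers below `x`.
  refine ⟨⌈x⌉₊ - 1, Nat.lt_ceil.1 (by omega), fun i => (ht i).mono ?_⟩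
  have := Nat.lt_ceil.2 (htx i)
  omega

end Locality

/-! ### Message transcripts and fooling sets across a narrow cut -/

section Transcript

/-- A code of the messages of at most `B` bits by bit vectors of length `B + 1`. -/
def encodeMessage (B : ℕ) (o : Option (List Bool)) (i : Fin (B + 1)) : Bool :=
  o.elim false fun l => (l ++ [true]).getD i false

theorem encodeMessage_some_length {B : ℕ} {l : List Bool} (hl : l.length ≤ B) :
    encodeMessage B (some l) ⟨l.length, by omega⟩ = true := by
  simp [encodeMessage]

theorem encodeMessage_some_of_length_lt {B : ℕ} {l : List Bool} {i : Fin (B + 1)}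
    (hi : l.length < i) : encodeMessage B (some l) i = false := by
  simp only [encodeMessage, Option.elim_some]
  exact List.getD_eq_default _ _ (by simp; omega)

/-- The appended `true` is the last set bit of the code, so the length of the message can be read
off; the zero vector is left for `none`. -/
theorem encodeMessage_injOn {B : ℕ} {o o' : Option (List Bool)} (ho : ∀ l, o = some l → l.length ≤ B)
    (ho' : ∀ l, o' = some l → l.length ≤ B) (h : encodeMessage B o = encodeMessage B o') :
    o = o' := by
  cases o with
  | none =>
    cases o' with
    | none => rfl
    | some l =>
      have := encodeMessage_some_length (ho' l rfl)
      rw [← h] at this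
      simp [encodeMessage] at this
  | some k =>
    have hk := encodeMessage_some_length (ho k rfl)
    cases o' with
    | none =>
      rw [h] at hk
      simp [encodeMessage] at hk
    | some l =>
      have hl := encodeMessage_some_length (ho' l rfl)
      have hlen : k.length = l.length := by
        rcases lt_trichotomy k.length l.length with hlt | heq | hlt
        · rw [← h, encodeMessage_some_of_length_lt (by simpa using hlt)] at hl
          simp at hl
        · exact heq
        · rw [h, encodeMessage_some_of_length_lt (by simpa using hlt)] at hk
          simp at hk
      congr 1
      refine List.ext_getElem hlen fun i hi hi' => ?_
      have hB := ho k rfl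
      have := congrFun h ⟨i, by omega⟩
      simpa [encodeMessage, List.getD_eq_getElem?_getD, List.getElem?_append, hi, hi'] using this

variable {V : Type}

/-- Two shrinking regions `R` and `L` such that in every round at most one edge carries a message
into `R` from outside `R`, and its sender lies in `L`; and vice versa. -/
structure NarrowCut (G : SimpleGraph V) (T : ℕ) (R L : ℕ → Set V) (r s l k : ℕ → V) : Prop where
  right_sub : ∀ t < T, R (t + 1) ⊆ R t
  left_sub : ∀ t < T, L (t + 1) ⊆ L t
  right_adj : ∀ t < T, ∀ v ∈ R (t + 1), ∀ w, G.Adj v w → w ∈ R t ∨ v = r t ∧ w = s t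
  left_adj : ∀ t < T, ∀ v ∈ L (t + 1), ∀ w, G.Adj v w → w ∈ L t ∨ v = l t ∧ w = k t
  right_source : ∀ t < T, s t ∈ L t
  left_source : ∀ t < T, k t ∈ R t

theorem NarrowCut.right_zero {G : SimpleGraph V} {T : ℕ} {R L : ℕ → Set V} {r s l k : ℕ → V}
    (hcut : NarrowCut G T R L r s l k) {t : ℕ} (ht : t ≤ T) : R t ⊆ R 0 := by
  induction t with
  | zero => exact subset_rfl
  | succ t ih => exact (hcut.right_sub t ht).trans (ih (by omega))

theorem NarrowCut.left_zero {G : SimpleGraph V} {T : ℕ} {R L : ℕ → Set V} {r s l k : ℕ → V}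
    (hcut : NarrowCut G T R L r s l k) {t : ℕ} (ht : t ≤ T) : L t ⊆ L 0 := by
  induction t with
  | zero => exact subset_rfl
  | succ t ih => exact (hcut.left_sub t ht).trans (ih (by omega))

variable [Fintype V] {A : Algorithm.{u}} {N : Network V}

/-- If two instances have the same messages over the critical edges, then an instance that looks
like the first one on the left and like the second one on the right behaves like them there. -/
theorem NarrowCut.config_eq {T : ℕ} {R L : ℕ → Set V} {r s l k : ℕ → V}
    (hcut : NarrowCut N.graph T R L r s l k) {I J K : Instance V}
    (hI : I.net = N) (hJ : J.net = N) (hK : K.net = N)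
    (hIK : I.awake = K.awake) (hJK : J.awake = K.awake)
    (hleft : ∀ v ∈ L 0, K.localInput v = I.localInput v)
    (hright : ∀ v ∈ R 0, K.localInput v = J.localInput v)
    (hr : ∀ t < T, A.arrival N (A.config I t) (r t) (s t) =
      A.arrival N (A.config J t) (r t) (s t))
    (hl : ∀ t < T, A.arrival N (A.config I t) (l t) (k t) =
      A.arrival N (A.config J t) (l t) (k t)) :
    ∀ t ≤ T, (∀ v ∈ L t, A.config K t v = A.config I t v) ∧
      ∀ v ∈ R t, A.config K t v = A.config J t v := by
  intro t
  induction t with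
  | zero =>
    exact fun _ => ⟨fun v hv => Algorithm.config_zero_congr hK hI hIK.symm (hleft v hv),
      fun v hv => Algorithm.config_zero_congr hK hJ hJK.symm (hright v hv)⟩
  | succ t ih =>
    intro ht
    obtain ⟨ihl, ihr⟩ := ih (by omega)
    constructor
    · intro v hv
      refine Algorithm.config_succ_congr hK hI (hleft v (hcut.left_zero ht hv))
        (ihl v (hcut.left_sub t ht hv)) fun w hw => ?_
      rcases hcut.left_adj t ht v hv w hw with h | ⟨rfl, rfl⟩
      · exact Algorithm.arrival_congr (ihl w h)
      · rw [hl t ht]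
        exact Algorithm.arrival_congr (ihr _ (hcut.left_source t ht))
    · intro v hv
      refine Algorithm.config_succ_congr hK hJ (hright v (hcut.right_zero ht hv))
        (ihr v (hcut.right_sub t ht hv)) fun w hw => ?_
      rcases hcut.right_adj t ht v hv w hw with h | ⟨rfl, rfl⟩
      · exact Algorithm.arrival_congr (ihr w h)
      · rw [← hr t ht]
        exact Algorithm.arrival_congr (ihl _ (hcut.right_source t ht))

/-- Fooling sets: an algorithm that is fast on a narrow cut distinguishes few inputs. -/
theorem NarrowCut.card_le {T B : ℕ} {R L : ℕ → Set V} {r s l k : ℕ → V}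
    (hcut : NarrowCut N.graph T R L r s l k) (hRT : (R T).Nonempty) {X : Type*} [Fintype X]
    {I : X → X → Instance V} (hnet : ∀ x y, (I x y).net = N) {S : Set V}
    (hS : ∀ x y, (I x y).awake = S)
    (hleft : ∀ v ∈ L 0, ∀ x y y', (I x y).localInput v = (I x y').localInput v)
    (hright : ∀ v ∈ R 0, ∀ x x' y, (I x y).localInput v = (I x' y).localInput v)
    (hyes : ∀ x, IsMST N.graph (I x x).weight (I x x).cand)
    (hno : ∀ x y, x ≠ y → ¬ IsMST N.graph (I x y).weight (I x y).cand ∨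
      ¬ IsMST N.graph (I y x).weight (I y x).cand)
    (hT : ∀ x y, A.SolvesBy (I x y) T) (hB : ∀ x, A.MessagesBounded (I x x) B) :
    Fintype.card X ≤ 2 ^ (2 * T * (B + 1)) := by
  classical
  by_contra! hlt
  -- The transcript of the diagonal input `x`: two messages per round, each one of at most `2 ^ (B +
  -- 1)` codes.
  let f : X → Fin T → (Fin (B + 1) → Bool) × (Fin (B + 1) → Bool) := fun x t =>
    (encodeMessage B (A.arrival N (A.config (I x x) t) (r t) (s t)),
      encodeMessage B (A.arrival N (A.config (I x x) t) (l t) (k t)))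
  have hcard : Fintype.card (Fin T → (Fin (B + 1) → Bool) × (Fin (B + 1) → Bool))
      < Fintype.card X := by
    refine lt_of_eq_of_lt ?_ hlt
    simp only [Fintype.card_fun, Fintype.card_prod, Fintype.card_bool, Fintype.card_fin]
    rw [← pow_add, ← pow_mul]
    congr 1
    ring
  obtain ⟨x, y, hxy, hf⟩ := Fintype.exists_ne_map_eq_of_card_lt f hcard
  have key : ∀ t < T,
      A.arrival N (A.config (I x x) t) (r t) (s t) = A.arrival N (A.config (I y y) t) (r t) (s t) ∧
      A.arrival N (A.config (I x x) t) (l t) (k t) =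
        A.arrival N (A.config (I y y) t) (l t) (k t) := by
    intro t ht
    have h := Prod.mk.inj (congrFun hf ⟨t, ht⟩)
    exact ⟨encodeMessage_injOn (fun _ => Algorithm.length_arrival_le (hnet x x) (hB x))
        (fun _ => Algorithm.length_arrival_le (hnet y y) (hB y)) h.1,
      encodeMessage_injOn (fun _ => Algorithm.length_arrival_le (hnet x x) (hB x))
        (fun _ => Algorithm.length_arrival_le (hnet y y) (hB y)) h.2⟩
  obtain ⟨z, hz⟩ := hRT
  -- Splicing: `I x y` looks like `I x x` on the left and like `I y y` on the right, so with equal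
  -- transcripts the vertex `z`, still in the right region at time `T`, must answer as in the
  -- yes-instance `I y y`. The claim is kept general in `x` and `y` because `hno` excludes only one
  -- of the two orders.
  have hcfg : ∀ x y, (∀ t < T,
      A.arrival N (A.config (I x x) t) (r t) (s t) = A.arrival N (A.config (I y y) t) (r t) (s t) ∧
      A.arrival N (A.config (I x x) t) (l t) (k t) =
        A.arrival N (A.config (I y y) t) (l t) (k t)) →
      IsMST N.graph (I x y).weight (I x y).cand := by
    intro x y key
    have h := (hcut.config_eq (hnet x x) (hnet y y) (hnet x y) (by rw [hS, hS]) (by rw [hS, hS])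
      (fun v hv => hleft v hv x y x) (fun v hv => hright v hv x y y)
      (fun t ht => (key t ht).1) (fun t ht => (key t ht).2) T le_rfl).2 z hz
    have := (hT x y).isMST_iff (hT y y) h
    rw [hnet, hnet] at this
    exact this.2 (hyes y)
  rcases hno x y hxy with h | h
  · exact h (hcfg x y key)
  · exact h (hcfg y x fun t ht => ⟨(key t ht).1.symm, (key t ht).2.symm⟩)

end Transcript

/-! ### The lower bound by the diameter -/

section Diameter

variable {V : Type} [Fintype V]

/-- A vertex at distance more than `T + 1` from `u` cannot see in `T` rounds a change of the
candidate at an edge incident to `u`. -/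
theorem Algorithm.config_eq_of_dist {A : Algorithm.{u}} {I J : Instance V} {N : Network V}
    (hI : I.net = N) (hJ : J.net = N) (hconn : N.graph.Connected) (haw : I.awake = J.awake)
    (hw : I.weight = J.weight) {u u' : V} (hu : N.graph.Adj u u')
    (hcand : ∀ e, e ≠ s(u, u') → (e ∈ I.cand ↔ e ∈ J.cand)) (t : ℕ) :
    ∀ v, t + 1 < N.graph.dist u v → A.config I t v = A.config J t v := by
  -- The changed edge is also seen by its other end `u'`, at distance 1; hence the offset `t + 1` in
  -- the claim.
  have hin : ∀ v, 1 < N.graph.dist u v → I.localInput v = J.localInput v := by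
    intro v hv
    refine Instance.localInput_congr hI hJ fun w _ => ⟨by rw [hw], hcand _ fun h => ?_⟩
    rw [Sym2.eq_iff] at h
    rcases h with ⟨rfl, -⟩ | ⟨rfl, -⟩
    · simp at hv
    · rw [SimpleGraph.dist_eq_one_iff_adj.2 hu] at hv
      omega
  induction t with
  | zero => exact fun v hv => Algorithm.config_zero_congr hI hJ haw (hin v hv)
  | succ t ih =>
    intro v hv
    refine Algorithm.config_succ_congr hI hJ (hin v (by omega)) (ih v (by omega)) fun w hvw => ?_
    refine Algorithm.arrival_congr (ih w ?_)
    have h1 := hconn.dist_triangle (u := u) (v := w) (w := v)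
    rw [SimpleGraph.dist_eq_one_iff_adj.2 hvw.symm] at h1
    omega

theorem isMST_zero_iff {V : Type} {G : SimpleGraph V} {T : Finset (Sym2 V)} :
    IsMST G (fun _ => 0) T ↔ IsSpanningTree G T := by
  simp [IsMST]

theorem exists_isSpanningTree {G : SimpleGraph V} (hG : G.Connected) :
    ∃ T : Finset (Sym2 V), IsSpanningTree G T := by
  classical
  obtain ⟨F, hF, hT⟩ := hG.exists_isTree_le
  refine ⟨F.edgeFinset, ?_, ?_⟩
  · simpa using hF
  · simpa using hT

theorem card_edgeSet_fromEdgeSet {V : Type} {G : SimpleGraph V} {T : Finset (Sym2 V)}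
    (hT : (T : Set (Sym2 V)) ⊆ G.edgeSet) :
    Nat.card (SimpleGraph.fromEdgeSet (T : Set (Sym2 V))).edgeSet = T.card := by
  have hE : (SimpleGraph.fromEdgeSet (T : Set (Sym2 V))).edgeSet = T := by
    rw [SimpleGraph.edgeSet_fromEdgeSet, sdiff_eq_left]
    exact Set.disjoint_left.2 fun e he hd => G.not_isDiag_of_mem_edgeSet (hT he) hd
  rw [hE]
  simp

/-- Removing an edge from a spanning tree leaves no spanning tree. -/
theorem not_isSpanningTree_erase [DecidableEq V] {G : SimpleGraph V} {T : Finset (Sym2 V)}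
    {e : Sym2 V} (hT : IsSpanningTree G T) (he : e ∈ T) : ¬ IsSpanningTree G (T.erase e) := by
  intro h
  have hcard : ∀ T : Finset (Sym2 V), IsSpanningTree G T → T.card + 1 = Fintype.card V := by
    intro T hT
    have := (SimpleGraph.isTree_iff_connected_and_card.1 hT.2).2
    rwa [card_edgeSet_fromEdgeSet hT.1, Nat.card_eq_fintype_card] at this
  have h1 := hcard _ hT
  have h2 := hcard _ h
  have := Finset.card_erase_lt_of_mem he
  omega

/-- With all weights 0 every spanning tree is minimum, so weights play no role and the answer
changes when a single tree edge is erased. -/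
theorem exists_needsTime_diam (N : Network V) (S : Set V) (κ : ℕ) (A : Algorithm.{u})
    (hconn : N.graph.Connected) (hD : 2 ≤ N.graph.diam) :
    ∃ I : Instance V, I.net = N ∧ I.awake = S ∧
      (∀ e ∈ N.graph.edgeSet, I.weight e ≤ Fintype.card V ^ κ) ∧
      A.NeedsTime I (1 / 2 * N.graph.diam) := by
  classical
  have := hconn.nonempty
  obtain ⟨u, v, huv⟩ := N.graph.exists_dist_eq_diam
  obtain ⟨T, hT⟩ := exists_isSpanningTree hconn
  have hne : u ≠ v := by
    rintro rfl
    simp at huv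
    omega
  obtain ⟨u', hu'⟩ : ∃ u', (SimpleGraph.fromEdgeSet (T : Set (Sym2 V))).Adj u u' := by
    obtain ⟨p⟩ := hT.2.connected.preconnected u v
    cases p with
    | nil => exact (hne rfl).elim
    | cons h _ => exact ⟨_, h⟩
  rw [SimpleGraph.fromEdgeSet_adj] at hu'
  have hadj : N.graph.Adj u u' := hT.1 hu'.1
  let I : Bool → Instance V := fun b =>
    { net := N
      weight := fun _ => 0
      cand := if b then T else T.erase s(u, u')
      cand_subset := by
        split_ifs
        · exact hT.1
        · exact (Finset.coe_subset.2 (Finset.erase_subset _ _)).trans hT.1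
      awake := S }
  by_contra! hcon
  obtain ⟨t, ht, hsolve⟩ := Algorithm.exists_solvesBy_of_forall_not_needsTime
    (A := A) (I := I) (x := 1 / 2 * N.graph.diam) fun b => hcon (I b) rfl rfl (by simp [I])
  -- From `2t < D` alone the case `t = 0` would fail for `D = 1`; here `2 ≤ D` enters.
  have ht' : t + 1 < N.graph.dist u v := by
    rw [huv]
    have h2 : (2 * t : ℝ) < N.graph.diam := by linarith
    have h3 : 2 * t < N.graph.diam := by exact_mod_cast h2
    omega
  have h := Algorithm.config_eq_of_dist (A := A) (I := I true) (J := I false) (N := N) rfl rfl hconn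
    rfl rfl hadj (fun e he => by simp [I, he]) t v ht'
  have h2 := (hsolve true).isMST_iff (hsolve false) h
  simp only [I, isMST_zero_iff] at h2
  exact not_isSpanningTree_erase hT hu'.1 (by simpa using h2.1 (by simpa using hT))

end Diameter

/-! ### Bounding distances by potentials and by chains -/

section Distance

variable {V : Type*} {G : SimpleGraph V}

/-- A function that grows by at most `c` along each edge bounds distances from below; used with
positions on `FGraph m` and with a distance potential on `tailGraph`. -/
theorem le_add_mul_dist (hG : G.Connected) {f : V → ℕ} {c : ℕ}
    (hf : ∀ a b, G.Adj a b → f b ≤ f a + c) (a b : V) : f b ≤ f a + c * G.dist a b := by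
  obtain ⟨p, hp⟩ := hG.exists_walk_length_eq_dist a b
  rw [← hp]
  clear hp
  induction p with
  | nil => simp
  | cons h p ih =>
    have := hf _ _ h
    rw [SimpleGraph.Walk.length_cons, mul_add]
    omega

/-- Phrased with `edist`, since a finite bound then also yields reachability, without assuming
connectedness. -/
theorem edist_le_of_chain {f : ℕ → V} {k : ℕ} (hf : ∀ i < k, G.Adj (f i) (f (i + 1))) {i j : ℕ}
    (hij : i ≤ j) (hj : j ≤ k) : G.edist (f i) (f j) ≤ (j - i : ℕ) := by
  induction j, hij using Nat.le_induction with
  | base => simp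
  | succ j hij ih =>
    refine (SimpleGraph.edist_triangle (v := f j)).trans ?_
    rw [SimpleGraph.edist_eq_one_iff_adj.2 (hf j (by omega)), Nat.sub_add_comm hij, Nat.cast_add,
      Nat.cast_one]
    exact add_le_add (ih (by omega)) le_rfl

theorem dist_le_of_edist_le {a b : V} {k : ℕ} (h : G.edist a b ≤ k) : G.dist a b ≤ k :=
  ENat.toNat_le_of_le_natCast h

theorem connected_of_edist_le {r : V} {k : ℕ} (h : ∀ v, G.edist r v ≤ k) : G.Connected := by
  have hr : ∀ v, G.Reachable r v := fun v =>
    SimpleGraph.edist_ne_top_iff_reachable.1 (ne_top_of_le_ne_top (by simp) (h v))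
  have : Nonempty V := ⟨r⟩
  exact ⟨fun a b => (hr a).symm.trans (hr b)⟩

theorem diam_le_of_dist_le [Nonempty V] {k : ℕ} (h : ∀ a b, G.dist a b ≤ k) : G.diam ≤ k := by
  obtain ⟨a, b, hab⟩ := G.exists_dist_eq_diam
  exact hab ▸ h a b

theorem dist_le_diam_of_connected [Finite V] (hG : G.Connected) (a b : V) :
    G.dist a b ≤ G.diam :=
  have := hG.nonempty
  SimpleGraph.dist_le_diam (SimpleGraph.connected_iff_ediam_ne_top.1 hG)

end Distance

/-! ### Connectedness, diameter and size of `FGraph m` -/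

section Highway

variable {m : ℕ}

/-- The highway vertex with number `i ≤ m`. -/
def hwy (m i : ℕ) : FVert m := Sum.inl (Fin.ofNat (m + 1) i)

/-- The vertex in position `x ≤ m²` of the `j`-th path. -/
def lane (m : ℕ) (j : Fin (m ^ 2)) (x : ℕ) : FVert m := Sum.inr (j, Fin.ofNat (m ^ 2 + 1) x)

theorem inl_eq_hwy (a : Fin (m + 1)) : (Sum.inl a : FVert m) = hwy m a := by
  simp [hwy]

theorem inr_eq_lane (j : Fin (m ^ 2)) (x : Fin (m ^ 2 + 1)) :
    (Sum.inr (j, x) : FVert m) = lane m j x := by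
  simp [lane]

theorem FGraph_adj_hwy {i : ℕ} (hi : i < m) : (FGraph m).Adj (hwy m i) (hwy m (i + 1)) := by
  have h1 : i % (m + 1) = i := Nat.mod_eq_of_lt (by omega)
  have h2 : (i + 1) % (m + 1) = i + 1 := Nat.mod_eq_of_lt (by omega)
  simp [FGraph, hwy, FRel, Fin.ext_iff, Fin.ofNat, h1, h2]

theorem FGraph_adj_lane (j : Fin (m ^ 2)) {x : ℕ} (hx : x < m ^ 2) :
    (FGraph m).Adj (lane m j x) (lane m j (x + 1)) := by
  have h1 : x % (m ^ 2 + 1) = x := Nat.mod_eq_of_lt (by omega)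
  have h2 : (x + 1) % (m ^ 2 + 1) = x + 1 := Nat.mod_eq_of_lt (by omega)
  simp [FGraph, lane, FRel, Fin.ext_iff, Fin.ofNat, h1, h2]

theorem FGraph_adj_spoke (j : Fin (m ^ 2)) {i : ℕ} (hi : i ≤ m) :
    (FGraph m).Adj (hwy m i) (lane m j (i * m)) := by
  have h3 : i * m ≤ m ^ 2 := by nlinarith
  have h1 : i % (m + 1) = i := Nat.mod_eq_of_lt (by omega)
  have h2 : (i * m) % (m ^ 2 + 1) = i * m := Nat.mod_eq_of_lt (by omega)
  simp [FGraph, hwy, lane, FRel, Fin.ofNat, h1, h2]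

/-- The position of a vertex of `F²ₘ`. -/
def pos (m : ℕ) : FVert m → ℕ
  | Sum.inl a => a * m
  | Sum.inr (_, x) => x

/-- The orientation never decreases the position, and only a highway edge can advance it by more
than one. Both the lower bound on the diameter and the narrow cut rest on this. -/
theorem FRel.pos_cases {v w : FVert m} (h : FRel m v w) :
    pos m v ≤ pos m w ∧ (pos m w ≤ pos m v + 1 ∨
      ∃ i < m, v = hwy m i ∧ w = hwy m (i + 1) ∧ pos m v = i * m ∧ pos m w = (i + 1) * m) := by
  rcases v with a | ⟨j, x⟩ <;> rcases w with b | ⟨k, y⟩ <;> simp only [FRel] at h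
  · have hb := b.is_le
    refine ⟨?_, .inr ⟨a, by omega, inl_eq_hwy a, ?_, rfl, ?_⟩⟩
    · simp only [pos, ← h]
      nlinarith
    · rw [inl_eq_hwy, h]
    · simp only [pos, h]
  · simp only [pos, h]
    omega
  · simp only [pos]
    omega

theorem FGraph_adj_iff {v w : FVert m} : (FGraph m).Adj v w ↔ v ≠ w ∧ (FRel m v w ∨ FRel m w v) :=
  SimpleGraph.fromRel_adj _ _ _

/-- Drive along the highway to the last spoke at or before the target (at most `m` edges), take it,
and walk fewer than `m` steps along the path. -/
theorem FGraph_edist_le (hm : 1 ≤ m) (v : FVert m) :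
    (FGraph m).edist (hwy m 0) v ≤ (2 * m : ℕ) := by
  have hh : ∀ i ≤ m, (FGraph m).edist (hwy m 0) (hwy m i) ≤ i := fun i hi => by
    simpa using edist_le_of_chain (f := hwy m) (k := m) (fun i hi => FGraph_adj_hwy hi)
      (Nat.zero_le i) hi
  rcases v with a | ⟨j, x⟩
  · rw [inl_eq_hwy]
    refine (hh a a.is_le).trans ?_
    have := a.is_le
    exact_mod_cast (by omega)
  · rw [inr_eq_lane]
    have hx := x.is_le
    have hdiv : (x : ℕ) / m ≤ m := Nat.div_le_of_le_mul (by rw [← sq]; exact hx)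
    have hle : (x : ℕ) / m * m ≤ x := Nat.div_mul_le_self _ _
    have hmod : (x : ℕ) - x / m * m < m := by
      have h1 := Nat.mod_lt (x : ℕ) hm
      have h2 := Nat.div_add_mod' (x : ℕ) m
      omega
    have h1 := hh _ hdiv
    have h2 := edist_le_of_chain (f := lane m j) (k := m ^ 2) (fun i hi => FGraph_adj_lane j hi)
      hle hx
    have h3 : (FGraph m).edist (hwy m 0) (lane m j x) ≤
        ((x / m : ℕ) : ℕ∞) + 1 + ((x - x / m * m : ℕ) : ℕ∞) := by
      refine (SimpleGraph.edist_triangle (v := lane m j (x / m * m))).trans (add_le_add ?_ h2)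
      refine (SimpleGraph.edist_triangle (v := hwy m (x / m))).trans (add_le_add h1 ?_)
      exact (SimpleGraph.edist_eq_one_iff_adj.2 (FGraph_adj_spoke j hdiv)).le
    refine h3.trans ?_
    exact_mod_cast (by omega)

theorem FGraph_connected (hm : 1 ≤ m) : (FGraph m).Connected :=
  connected_of_edist_le (FGraph_edist_le hm)

theorem FGraph_dist_le (hm : 1 ≤ m) (v w : FVert m) : (FGraph m).dist v w ≤ 4 * m := by
  have h1 := dist_le_of_edist_le (FGraph_edist_le hm v)
  have h2 := dist_le_of_edist_le (FGraph_edist_le hm w)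
  have h3 := (FGraph_connected hm).dist_triangle (u := v) (v := hwy m 0) (w := w)
  rw [SimpleGraph.dist_comm] at h1
  omega

theorem FGraph_diam_le (hm : 1 ≤ m) : (FGraph m).diam ≤ 4 * m :=
  diam_le_of_dist_le (FGraph_dist_le hm)

/-- An edge changes the position by at most `m`, while the two ends of the highway differ by `m²`.
-/
theorem le_FGraph_diam (hm : 1 ≤ m) : m ≤ (FGraph m).diam := by
  have h := le_add_mul_dist (FGraph_connected hm) (f := pos m) (c := m) (fun a b hab => by
    rcases (FGraph_adj_iff.1 hab).2 with h | h
    · rcases h.pos_cases with ⟨-, h | ⟨i, -, -, -, h, h'⟩⟩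
      · omega
      · rw [h, h', add_mul, one_mul]
    · have := h.pos_cases.1
      omega) (hwy m 0) (hwy m m)
  have h0 : pos m (hwy m 0) = 0 := by simp [pos, hwy]
  have h1 : pos m (hwy m m) = m * m := by simp [pos, hwy, Fin.ofNat]
  rw [h0, h1, zero_add] at h
  exact (Nat.le_of_mul_le_mul_left h hm).trans (dist_le_diam_of_connected (FGraph_connected hm) _ _)

theorem card_FVert (m : ℕ) : Fintype.card (FVert m) = m ^ 4 + m ^ 2 + m + 1 := by
  simp only [FVert, Fintype.card_sum, Fintype.card_prod, Fintype.card_fin]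
  ring

theorem card_FVert_le (hm : 1 ≤ m) : Fintype.card (FVert m) ≤ 4 * m ^ 4 := by
  rw [card_FVert]
  have h1 : m ^ 2 ≤ m ^ 4 := Nat.pow_le_pow_right hm (by norm_num)
  have h2 : m ≤ m ^ 4 := Nat.le_self_pow (by norm_num) m
  omega

end Highway

/-! ### Attaching a path and leaves to prescribe order and diameter -/

section Extension

/-- The graph `G` arises from `F` by attaching further vertices to the root `r`; `tree` is a set of
edges that spans the attached part. -/
structure RootedExtension {U V : Type} [Fintype U] [Fintype V] (F : SimpleGraph U) (r : U)
    (G : SimpleGraph V) where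
  emb : U → V
  retr : V → U
  retr_emb : ∀ a, retr (emb a) = a
  adj_emb : ∀ a b, F.Adj a b → G.Adj (emb a) (emb b)
  adj_cases : ∀ v w, G.Adj v w → retr v = r ∧ retr w = r ∨
    emb (retr v) = v ∧ emb (retr w) = w ∧ F.Adj (retr v) (retr w)
  tree : Finset (Sym2 V)
  tree_subset : (tree : Set (Sym2 V)) ⊆ G.edgeSet
  map_tree : ∀ e ∈ tree, e.map retr = s(r, r)
  tree_card : tree.card + Fintype.card U ≤ Fintype.card V
  tree_reachable : ∀ v, (SimpleGraph.fromEdgeSet (tree : Set (Sym2 V))).Reachable v (emb (retr v))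

/-- Every graph is an extension of itself. -/
def RootedExtension.refl {U : Type} [Fintype U] {F G : SimpleGraph U} (r : U) (h : G = F) :
    RootedExtension F r G where
  emb := id
  retr := id
  retr_emb _ := rfl
  adj_emb _ _ hab := h ▸ hab
  adj_cases _ _ hvw := .inr ⟨rfl, rfl, h ▸ hvw⟩
  tree := ∅
  tree_subset := by simp
  map_tree := by simp
  tree_card := by simp
  tree_reachable _ := SimpleGraph.Reachable.refl _

variable {U : Type} (F : SimpleGraph U) (r : U) (q k : ℕ)

/-- The vertex to which the attached vertex `i` is joined: the first `k` of them form a path that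
starts at the root, the others are leaves at the root. -/
def tailParent (i : Fin q) : U ⊕ Fin q :=
  if 0 < (i : ℕ) ∧ (i : ℕ) < k then Sum.inr ⟨i - 1, by omega⟩ else Sum.inl r

/-- The edges of `tailGraph` in one orientation. -/
def TailRel : U ⊕ Fin q → U ⊕ Fin q → Prop
  | Sum.inl a, Sum.inl b => F.Adj a b
  | Sum.inr i, w => w = tailParent r q k i
  | Sum.inl _, Sum.inr _ => False

/-- The graph `F` with a path of `k` further vertices and `q - k` leaves attached to `r`. -/
def tailGraph : SimpleGraph (U ⊕ Fin q) := SimpleGraph.fromRel (TailRel F r q k)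

variable {F r q k}

theorem tailParent_ne (i : Fin q) : tailParent r q k i ≠ Sum.inr i := by
  unfold tailParent
  split_ifs with h
  · simp [Fin.ext_iff]
    omega
  · simp

theorem tailGraph_adj_inl {a b : U} :
    (tailGraph F r q k).Adj (Sum.inl a) (Sum.inl b) ↔ F.Adj a b := by
  simp only [tailGraph, SimpleGraph.fromRel_adj, TailRel, ne_eq, Sum.inl.injEq, F.adj_comm b a,
    or_self, and_iff_right_iff_imp]
  exact fun h => h.ne

theorem tailGraph_adj_parent (i : Fin q) :
    (tailGraph F r q k).Adj (Sum.inr i) (tailParent r q k i) := by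
  simp only [tailGraph, SimpleGraph.fromRel_adj, TailRel]
  exact ⟨(tailParent_ne i).symm, .inl trivial⟩

theorem tailGraph_adj_cases {v w : U ⊕ Fin q} (h : (tailGraph F r q k).Adj v w) :
    (∃ a b, v = Sum.inl a ∧ w = Sum.inl b ∧ F.Adj a b) ∨
      (∃ i, v = Sum.inr i ∧ w = tailParent r q k i) ∨
      ∃ i, w = Sum.inr i ∧ v = tailParent r q k i := by
  simp only [tailGraph, SimpleGraph.fromRel_adj] at h
  rcases v with a | i <;> rcases w with b | j <;> simp only [TailRel] at h
  · exact .inl ⟨a, b, rfl, rfl, h.2.elim id fun h => h.symm⟩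
  · exact .inr (.inr ⟨j, rfl, by tauto⟩)
  · exact .inr (.inl ⟨i, rfl, by tauto⟩)
  · rcases h.2 with h | h
    · exact .inr (.inl ⟨i, rfl, h⟩)
    · exact .inr (.inr ⟨j, rfl, h⟩)

theorem tailParent_cases (i : Fin q) :
    (tailParent r q k i = Sum.inl r ∧ ¬ (0 < (i : ℕ) ∧ (i : ℕ) < k)) ∨
      ∃ j : Fin q, (j : ℕ) + 1 = i ∧ (i : ℕ) < k ∧ tailParent r q k i = Sum.inr j := by
  unfold tailParent
  split_ifs with h
  · exact .inr ⟨⟨i - 1, by omega⟩, Nat.sub_add_cancel h.1, h.2, rfl⟩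
  · exact .inl ⟨rfl, h⟩

/-- The retraction of `tailGraph` onto `F` that sends the attached vertices to the root. -/
def tailRetr (r : U) (q : ℕ) : U ⊕ Fin q → U := Sum.elim id fun _ => r

theorem tailRetr_parent (i : Fin q) : tailRetr r q (tailParent r q k i) = r := by
  rcases tailParent_cases (r := r) (k := k) i with ⟨h, -⟩ | ⟨j, -, -, h⟩ <;> rw [h] <;> rfl

open Classical in
/-- `tailGraph` as an extension of `F`. -/
noncomputable def tailExtension [Fintype U] : RootedExtension F r (tailGraph F r q k) where
  emb := Sum.inl
  retr := tailRetr r q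
  retr_emb _ := rfl
  adj_emb a b := tailGraph_adj_inl.2
  adj_cases v w h := by
    rcases tailGraph_adj_cases h with ⟨a, b, rfl, rfl, hab⟩ | ⟨i, rfl, rfl⟩ | ⟨i, rfl, rfl⟩
    · exact .inr ⟨rfl, rfl, hab⟩
    · exact .inl ⟨rfl, tailRetr_parent i⟩
    · exact .inl ⟨tailRetr_parent i, rfl⟩
  tree := Finset.univ.image fun i => s(Sum.inr i, tailParent r q k i)
  tree_subset := by
    intro e he
    simp only [Finset.coe_image, Finset.coe_univ, Set.image_univ, Set.mem_range] at he
    obtain ⟨i, rfl⟩ := he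
    exact tailGraph_adj_parent i
  map_tree := by
    intro e he
    obtain ⟨i, -, rfl⟩ := Finset.mem_image.1 he
    rw [Sym2.map_mk, tailRetr_parent]
    rfl
  tree_card := by
    have : (Finset.univ.image fun i : Fin q =>
        s((Sum.inr i : U ⊕ Fin q), tailParent r q k i)).card ≤ q :=
      Finset.card_image_le.trans (by simp)
    rw [Fintype.card_sum, Fintype.card_fin]
    omega
  tree_reachable := by
    rintro (a | i)
    · exact SimpleGraph.Reachable.refl _
    · obtain ⟨i, hi⟩ := i
      induction i using Nat.strong_induction_on with
      | _ i ih =>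
        have hadj : (SimpleGraph.fromEdgeSet ((Finset.univ.image fun i : Fin q =>
            s((Sum.inr i : U ⊕ Fin q), tailParent r q k i) : Finset _) : Set _)).Adj
            (Sum.inr ⟨i, hi⟩) (tailParent r q k ⟨i, hi⟩) := by
          rw [SimpleGraph.fromEdgeSet_adj]
          exact ⟨Finset.mem_coe.2 (Finset.mem_image_of_mem _ (Finset.mem_univ _)),
            (tailParent_ne _).symm⟩
        refine hadj.reachable.trans ?_
        rcases tailParent_cases (r := r) (k := k) ⟨i, hi⟩ with ⟨h, -⟩ | ⟨j, hj, -, h⟩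
        · rw [h]
          exact SimpleGraph.Reachable.refl _
        · rw [h]
          exact ih j (by simp only at hj; omega) j.2

/-- The distance of an attached vertex from the root. -/
def tailLevel (q k : ℕ) (i : Fin q) : ℕ := if (i : ℕ) < k then i + 1 else 1

/-- The root followed by the attached path. -/
def tailPath (r : U) (q : ℕ) : ℕ → U ⊕ Fin q
  | 0 => Sum.inl r
  | t + 1 => if h : t < q then Sum.inr ⟨t, h⟩ else Sum.inl r

theorem tailPath_adj (hkq : k ≤ q) {t : ℕ} (ht : t < k) :
    (tailGraph F r q k).Adj (tailPath r q t) (tailPath r q (t + 1)) := by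
  have htq : t < q := by omega
  have h := (tailGraph_adj_parent (F := F) (r := r) (k := k) ⟨t, htq⟩).symm
  have h2 : tailPath r q (t + 1) = Sum.inr ⟨t, htq⟩ := by simp [tailPath, htq]
  have h1 : tailPath r q t = tailParent r q k ⟨t, htq⟩ := by
    rcases tailParent_cases (r := r) (k := k) ⟨t, htq⟩ with ⟨h, hn⟩ | ⟨j, hj, -, h⟩
    · obtain rfl : t = 0 := by simp only at hn; omega
      rw [h]
      rfl
    · simp only at hj
      subst hj
      rw [h]
      simp [tailPath]
  rwa [h1, h2]

theorem tailGraph_edist_root_le (hkq : k ≤ q) (i : Fin q) :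
    (tailGraph F r q k).edist (Sum.inl r) (Sum.inr i) ≤ tailLevel q k i := by
  unfold tailLevel
  split_ifs with h
  · have := edist_le_of_chain (f := tailPath r q)
      (fun t ht => tailPath_adj (F := F) hkq ht) (Nat.zero_le (i + 1)) h
    simpa [tailPath] using this
  · rcases tailParent_cases (r := r) (k := k) i with ⟨h', -⟩ | ⟨j, -, h', -⟩
    · have := (tailGraph_adj_parent (F := F) (r := r) (k := k) i).symm
      rw [h'] at this
      exact (SimpleGraph.edist_eq_one_iff_adj.2 this).le
    · exact absurd h' h

theorem tailGraph_edist_inl_le (hF : F.Connected) (a b : U) :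
    (tailGraph F r q k).edist (Sum.inl a) (Sum.inl b) ≤ F.dist a b := by
  obtain ⟨p, hp⟩ := hF.exists_walk_length_eq_dist a b
  let φ : F →g tailGraph F r q k := ⟨Sum.inl, fun h => tailGraph_adj_inl.2 h⟩
  rw [← hp, ← SimpleGraph.Walk.length_map φ p]
  exact SimpleGraph.edist_le (p.map φ)

theorem tailLevel_le (hk : 1 ≤ k) (i : Fin q) : tailLevel q k i ≤ k := by
  unfold tailLevel
  split_ifs <;> omega

theorem tailGraph_connected (hF : F.Connected) (hkq : k ≤ q) :
    (tailGraph F r q k).Connected := by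
  have hr : ∀ v, (tailGraph F r q k).Reachable (Sum.inl r) v := by
    rintro (a | i)
    · exact SimpleGraph.edist_ne_top_iff_reachable.1
        (ne_top_of_le_ne_top (by simp) (tailGraph_edist_inl_le hF r a))
    · exact SimpleGraph.edist_ne_top_iff_reachable.1
        (ne_top_of_le_ne_top (by simp) (tailGraph_edist_root_le hkq i))
  have : Nonempty (U ⊕ Fin q) := ⟨Sum.inl r⟩
  exact ⟨fun a b => (hr a).symm.trans (hr b)⟩

/-- The diameter of `tailGraph` is the eccentricity of the root plus the length of the path. -/
theorem tailGraph_diam [Fintype U] (hF : F.Connected) (hk : 1 ≤ k) (hkq : k ≤ q) {e : ℕ}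
    (he : 1 ≤ e) (hecc : ∀ a, F.dist r a ≤ e) {z : U} (hz : F.dist r z = e)
    (hdist : ∀ a b, F.dist a b ≤ e + k) : (tailGraph F r q k).diam = e + k := by
  have hconn := tailGraph_connected (r := r) hF hkq
  have hinl := fun a b => dist_le_of_edist_le (tailGraph_edist_inl_le (r := r) (q := q) (k := k) hF a b)
  have hroot := fun i => dist_le_of_edist_le (tailGraph_edist_root_le (F := F) (r := r) hkq i)
  have hmixed : ∀ a i, (tailGraph F r q k).dist (Sum.inl a) (Sum.inr i) ≤ e + k := by
    intro a i
    have h1 := hconn.dist_triangle (u := Sum.inl a) (v := Sum.inl r) (w := Sum.inr i)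
    have h2 := hinl a r
    have h3 := hecc a
    have h4 := hroot i
    have h5 := tailLevel_le hk i
    rw [SimpleGraph.dist_comm] at h3
    omega
  have htail : ∀ i j : Fin q, (i : ℕ) ≤ j → (j : ℕ) < k →
      (tailGraph F r q k).dist (Sum.inr i) (Sum.inr j) ≤ e + k := by
    intro i j hij hj
    have := dist_le_of_edist_le (edist_le_of_chain (f := tailPath r q)
      (fun t ht => tailPath_adj (F := F) hkq ht) (Nat.succ_le_succ hij) hj)
    simp only [tailPath, Fin.is_lt, dite_true, Fin.eta, Nat.succ_eq_add_one] at this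
    omega
  have hleaf : ∀ i j : Fin q, ¬ (i : ℕ) < k →
      (tailGraph F r q k).dist (Sum.inr i) (Sum.inr j) ≤ e + k := by
    -- A leaf has level 1, so a detour through the root costs at most `1 + k`; this is where `1 ≤ e`
    -- is needed.
    intro i j hi
    have h1 := hconn.dist_triangle (u := Sum.inr i) (v := Sum.inl r) (w := Sum.inr j)
    have h2 := hroot i
    have h3 := hroot j
    have h4 := tailLevel_le hk j
    have h5 : tailLevel q k i = 1 := by simp [tailLevel, hi]
    rw [SimpleGraph.dist_comm] at h2
    omega
  have : Nonempty (U ⊕ Fin q) := ⟨Sum.inl r⟩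
  refine le_antisymm (diam_le_of_dist_le ?_) ?_
  · rintro (a | i) (b | j)
    · exact (hinl a b).trans (hdist a b)
    · exact hmixed a j
    · rw [SimpleGraph.dist_comm]
      exact hmixed b i
    · by_cases hi : (i : ℕ) < k
      · by_cases hj : (j : ℕ) < k
        · rcases le_total (i : ℕ) j with h | h
          · exact htail i j h hj
          · rw [SimpleGraph.dist_comm]
            exact htail j i h hi
        · rw [SimpleGraph.dist_comm]
          exact hleaf j i hj
      · exact hleaf i j hi
  · let f : U ⊕ Fin q → ℕ := Sum.elim (fun a => F.dist z a) fun i => e + tailLevel q k i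
    have hzr : F.dist z r = e := by rw [SimpleGraph.dist_comm, hz]
    have hpar : ∀ i : Fin q, f (Sum.inr i) = f (tailParent r q k i) + 1 := by
      intro i
      rcases tailParent_cases (r := r) (k := k) i with ⟨h, hn⟩ | ⟨j, hj, hi, h⟩ <;> rw [h]
      · simp only [f, Sum.elim_inr, Sum.elim_inl, hzr, tailLevel]
        split_ifs <;> omega
      · simp only [f, Sum.elim_inr, tailLevel]
        split_ifs <;> omega
    have hlip := le_add_mul_dist hconn (f := f) (c := 1) (fun a b hab => by
      rcases tailGraph_adj_cases hab with ⟨a, b, rfl, rfl, h⟩ | ⟨i, rfl, rfl⟩ | ⟨i, rfl, rfl⟩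
      · have := hF.dist_triangle (u := z) (v := a) (w := b)
        rw [SimpleGraph.dist_eq_one_iff_adj.2 h] at this
        simpa [f] using this
      · have := hpar i
        omega
      · exact (hpar i).le) (Sum.inl z) (Sum.inr ⟨k - 1, by omega⟩)
    have h1 : f (Sum.inl z) = 0 := by simp [f]
    have h2 : f (Sum.inr ⟨k - 1, by omega⟩) = e + k := by
      simp only [f, Sum.elim_inr, tailLevel]
      split_ifs <;> omega
    rw [h1, h2] at hlip
    have := dist_le_diam_of_connected hconn (Sum.inl z) (Sum.inr ⟨k - 1, by omega⟩)
    omega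

end Extension

/-! ### Weights and candidates coded by bit vectors -/

section Family

variable {m : ℕ}

/-- The weight of the spoke from the `a`-th highway vertex to the `j`-th path. -/
def spokeWeight (x : Fin (m ^ 2) → Bool) (a : Fin (m + 1)) (j : Fin (m ^ 2)) : ℕ :=
  if (a : ℕ) = 0 then (if x j then 1 else 3) else if (a : ℕ) = m then 2 else 4

/-- The weights of the family `𝒥²ₘ`, coded by bit vectors. -/
def jWeightFun (x : Fin (m ^ 2) → Bool) : FVert m → FVert m → ℕ
  | Sum.inl a, Sum.inr (j, _) => spokeWeight x a j
  | Sum.inr (j, _), Sum.inl a => spokeWeight x a j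
  | Sum.inl _, Sum.inl _ => 0
  | Sum.inr _, Sum.inr _ => 0

/-- The weights of the family `𝒥²ₘ`, as a function of the edges. -/
def jWeight (x : Fin (m ^ 2) → Bool) : Sym2 (FVert m) → ℕ :=
  Sym2.lift ⟨jWeightFun x, by rintro (a | ⟨j, y⟩) (b | ⟨k, z⟩) <;> rfl⟩

theorem isJWeight_jWeight (hm : 1 ≤ m) (x : Fin (m ^ 2) → Bool) : IsJWeight m (jWeight x) where
  highway _ _ _ := rfl
  path _ _ _ _ := rfl
  innerSpoke a j z _ h0 hm := by simp [jWeight, jWeightFun, spokeWeight, h0, hm]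
  lastSpoke a j z _ h := by
    have : (a : ℕ) ≠ 0 := by omega
    simp [jWeight, jWeightFun, spokeWeight, h]
    omega
  firstSpoke a j z _ h := by
    cases hx : x j <;> simp [jWeight, jWeightFun, spokeWeight, h, hx]

theorem jWeight_le (x : Fin (m ^ 2) → Bool) (e : Sym2 (FVert m)) : jWeight x e ≤ 4 := by
  induction e using Sym2.ind with
  | _ v w =>
    rcases v with a | ⟨j, y⟩ <;> rcases w with b | ⟨k, z⟩ <;>
      simp only [jWeight, Sym2.lift_mk, jWeightFun, spokeWeight] <;> (try split_ifs) <;> omega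

/-- Which edges belong to the candidate: of the spokes, those with number `0` whose bit in `x` is
set and those with number `m` whose bit in `y` is not set. -/
def jMarkFun (x y : Fin (m ^ 2) → Bool) : FVert m → FVert m → Prop
  | Sum.inl a, Sum.inr (j, _) => (a : ℕ) = 0 ∧ x j = true ∨ (a : ℕ) = m ∧ y j = false
  | Sum.inr (j, _), Sum.inl a => (a : ℕ) = 0 ∧ x j = true ∨ (a : ℕ) = m ∧ y j = false
  | Sum.inl _, Sum.inl _ => True
  | Sum.inr _, Sum.inr _ => True

theorem jMarkFun_comm (x y : Fin (m ^ 2) → Bool) (v w : FVert m) :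
    jMarkFun x y v w = jMarkFun x y w v := by
  rcases v with a | ⟨j, y⟩ <;> rcases w with b | ⟨k, z⟩ <;> rfl

open Classical in
/-- The candidate coded by two bit vectors. -/
noncomputable def jCand (x y : Fin (m ^ 2) → Bool) : Finset (Sym2 (FVert m)) :=
  Finset.univ.filter fun e =>
    e ∈ (FGraph m).edgeSet ∧ Sym2.lift ⟨jMarkFun x y, jMarkFun_comm x y⟩ e

theorem mk_mem_jCand {x y : Fin (m ^ 2) → Bool} {v w : FVert m} :
    s(v, w) ∈ jCand x y ↔ (FGraph m).Adj v w ∧ jMarkFun x y v w := by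
  simp [jCand]

theorem jCand_subset (x y : Fin (m ^ 2) → Bool) :
    (jCand x y : Set (Sym2 (FVert m))) ⊆ (FGraph m).edgeSet := by
  intro e he
  simp only [jCand, Finset.coe_filter, Finset.mem_univ, true_and, Set.mem_ofPred_eq] at he
  exact he.1

theorem FGraph_adj_spoke_iff {a : Fin (m + 1)} {j : Fin (m ^ 2)} {z : Fin (m ^ 2 + 1)} :
    (FGraph m).Adj (Sum.inl a) (Sum.inr (j, z)) ↔ (z : ℕ) = a * m := by
  simp [FGraph_adj_iff, FRel]

/-- The bits of `x` enter only through the first spokes, and these have both ends at position 0. -/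
theorem jWeight_congr {x x' : Fin (m ^ 2) → Bool} {v w : FVert m} (hv : 0 < pos m v)
    (h : (FGraph m).Adj v w) : jWeight x s(v, w) = jWeight x' s(v, w) := by
  rcases v with a | ⟨j, z⟩ <;> rcases w with b | ⟨k, z'⟩ <;>
    simp only [jWeight, Sym2.lift_mk, jWeightFun, spokeWeight, pos] at *
  · have : (a : ℕ) ≠ 0 := by rintro h; simp [h] at hv
    simp [this]
  · have : (b : ℕ) ≠ 0 := by
      rintro hb
      rw [FGraph_adj_spoke_iff.1 h.symm, hb] at hv
      simp at hv
    simp [this]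

theorem mem_jCand_congr_left {x x' y : Fin (m ^ 2) → Bool} {v w : FVert m} (hv : 0 < pos m v) :
    s(v, w) ∈ jCand x y ↔ s(v, w) ∈ jCand x' y := by
  simp only [mk_mem_jCand]
  refine and_congr_right fun h => ?_
  rcases v with a | ⟨j, z⟩ <;> rcases w with b | ⟨k, z'⟩ <;> simp only [jMarkFun, pos] at *
  · have : (a : ℕ) ≠ 0 := by rintro h; simp [h] at hv
    simp [this]
  · have : (b : ℕ) ≠ 0 := by
      rintro hb
      rw [FGraph_adj_spoke_iff.1 h.symm, hb] at hv
      simp at hv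
    simp [this]

theorem mem_jCand_congr_right {x y y' : Fin (m ^ 2) → Bool} {v w : FVert m}
    (hv : pos m v < m ^ 2) : s(v, w) ∈ jCand x y ↔ s(v, w) ∈ jCand x y' := by
  simp only [mk_mem_jCand]
  refine and_congr_right fun h => ?_
  rcases v with a | ⟨j, z⟩ <;> rcases w with b | ⟨k, z'⟩ <;> simp only [jMarkFun, pos] at *
  · have : (a : ℕ) ≠ m := by rintro h; simp [h, sq] at hv
    simp [this]
  · have : (b : ℕ) ≠ m := by
      rintro hb
      rw [FGraph_adj_spoke_iff.1 h.symm, hb] at hv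
      simp [sq] at hv
    simp [this]

/-- The parent of a vertex in the spanning tree `jCand x x`. -/
def jParent (x : Fin (m ^ 2) → Bool) : FVert m → FVert m
  | Sum.inl a => hwy m (a - 1)
  | Sum.inr (j, z) =>
    if x j then (if (z : ℕ) = 0 then hwy m 0 else lane m j (z - 1))
    else (if (z : ℕ) = m ^ 2 then hwy m m else lane m j (z + 1))

/-- Root the candidate at `hwy m 0`: a path with set bit is directed to its first spoke, any other
to its last. The inclusion suffices, as it bounds from above both the number of edges and the total
weight. -/
theorem jCand_subset_image_jParent (x : Fin (m ^ 2) → Bool) :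
    jCand x x ⊆ (Finset.univ.erase (hwy m 0)).image fun v => s(v, jParent x v) := by
  have key : ∀ v w, FRel m v w → jMarkFun x x v w →
      s(v, w) ∈ (Finset.univ.erase (hwy m 0)).image fun v => s(v, jParent x v) := by
    intro v w h hmark
    simp only [Finset.mem_image, Finset.mem_erase, Finset.mem_univ, and_true]
    rcases v with a | ⟨j, z⟩ <;> rcases w with b | ⟨k, z'⟩ <;> simp only [FRel, jMarkFun] at h hmark
    · refine ⟨Sum.inl b, ?_, ?_⟩
      · intro hb
        have : (b : ℕ) = 0 := by simp [Sum.inl.inj hb]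
        omega
      · rw [Sym2.eq_swap, inl_eq_hwy a]
        simp only [jParent, ← h, Nat.add_sub_cancel]
    · refine ⟨Sum.inr (k, z'), by simp [hwy], ?_⟩
      rw [Sym2.eq_swap, inl_eq_hwy a]
      simp only [jParent]
      rcases hmark with ⟨ha, hx⟩ | ⟨ha, hx⟩
      · rw [ha, zero_mul] at h
        simp [hx, h, ha]
      · rw [ha, ← sq] at h
        simp [hx, h, ha]
    · obtain ⟨rfl, h⟩ := h
      cases hx : x j with
      | true =>
        refine ⟨Sum.inr (j, z'), by simp [hwy], ?_⟩
        rw [Sym2.eq_swap, inr_eq_lane j z]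
        simp [jParent, hx, ← h]
      | false =>
        refine ⟨Sum.inr (j, z), by simp [hwy], ?_⟩
        have : (z : ℕ) ≠ m ^ 2 := by have := z'.is_le; omega
        rw [inr_eq_lane j z']
        simp [jParent, hx, ← h, this]
  intro e
  induction e using Sym2.ind with
  | _ v w =>
    rw [mk_mem_jCand, FGraph_adj_iff]
    rintro ⟨⟨-, h | h⟩, hmark⟩
    · exact key v w h hmark
    · rw [Sym2.eq_swap]
      exact key w v h (by rwa [jMarkFun_comm])

theorem card_jCand_lt (x : Fin (m ^ 2) → Bool) :
    (jCand x x).card < Fintype.card (FVert m) := by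
  refine (Finset.card_le_card (jCand_subset_image_jParent x)).trans_lt ?_
  refine Finset.card_image_le.trans_lt ?_
  exact Finset.card_erase_lt_of_mem (Finset.mem_univ _)

theorem jCand_connected (x : Fin (m ^ 2) → Bool) :
    (SimpleGraph.fromEdgeSet (jCand x x : Set (Sym2 (FVert m)))).Connected := by
  set H := SimpleGraph.fromEdgeSet (jCand x x : Set (Sym2 (FVert m))) with hH
  have hadj : ∀ v w, (FGraph m).Adj v w → jMarkFun x x v w → H.Adj v w := fun v w h hmark => by
    rw [hH, SimpleGraph.fromEdgeSet_adj, Finset.mem_coe, mk_mem_jCand]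
    exact ⟨⟨h, hmark⟩, h.ne⟩
  have hreach : ∀ {v w : FVert m} {n : ℕ}, H.edist v w ≤ n → H.Reachable v w := fun h =>
    SimpleGraph.edist_ne_top_iff_reachable.1 (ne_top_of_le_ne_top (by simp) h)
  have hh : ∀ i ≤ m, H.Reachable (hwy m 0) (hwy m i) := fun i hi =>
    hreach (edist_le_of_chain (f := hwy m) (fun i hi => hadj _ _ (FGraph_adj_hwy hi) trivial)
      (Nat.zero_le i) hi)
  have hl : ∀ j, ∀ i z, i ≤ z → z ≤ m ^ 2 → H.Reachable (lane m j i) (lane m j z) :=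
    fun j i z hi hz =>
      hreach (edist_le_of_chain (f := lane m j)
        (fun i hi => hadj _ _ (FGraph_adj_lane j hi) trivial) hi hz)
  have hroot : ∀ v, H.Reachable (hwy m 0) v := by
    rintro (a | ⟨j, z⟩)
    · rw [inl_eq_hwy]
      exact hh a a.is_le
    · rw [inr_eq_lane]
      cases hx : x j with
      | true =>
        have h := FGraph_adj_spoke j (Nat.zero_le m)
        rw [zero_mul] at h
        refine (hadj _ _ h ?_).reachable.trans (hl j 0 z (Nat.zero_le _) z.is_le)
        exact .inl ⟨by simp, hx⟩
      | false =>
        have h := FGraph_adj_spoke j (le_refl m)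
        rw [← sq] at h
        refine ((hh m le_rfl).trans (hadj _ _ h ?_).reachable).trans
          (hl j z (m ^ 2) z.is_le le_rfl).symm
        exact .inr ⟨by simp [Fin.ofNat], hx⟩
  have : Nonempty (FVert m) := ⟨hwy m 0⟩
  exact ⟨fun a b => (hroot a).symm.trans (hroot b)⟩

/-- The least weight of a spoke of the `j`-th path. -/
def minSpoke (x : Fin (m ^ 2) → Bool) (j : Fin (m ^ 2)) : ℕ := if x j then 1 else 2

theorem minSpoke_le (x : Fin (m ^ 2) → Bool) (a : Fin (m + 1)) (j : Fin (m ^ 2))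
    (z : Fin (m ^ 2 + 1)) : minSpoke x j ≤ jWeight x s(Sum.inl a, Sum.inr (j, z)) := by
  simp only [minSpoke, jWeight, Sym2.lift_mk, jWeightFun, spokeWeight]
  split_ifs <;> omega

theorem sum_image_le_sum {ι α : Type*} [DecidableEq α] (s : Finset ι) (g : ι → α) (f : α → ℕ) :
    ∑ a ∈ s.image g, f a ≤ ∑ i ∈ s, f (g i) := by
  classical
  induction s using Finset.induction_on with
  | empty => simp
  | insert i s hi ih =>
    rw [Finset.image_insert, Finset.sum_insert hi]
    by_cases h : g i ∈ s.image g
    · rw [Finset.insert_eq_of_mem h]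
      omega
    · rw [Finset.sum_insert h]
      omega

/-- Summing over parent edges, each path pays only for the spoke at its top: the first (weight 1) or
the last (weight 2). -/
theorem sum_jCand_le (hm : 1 ≤ m) (x : Fin (m ^ 2) → Bool) :
    ∑ e ∈ jCand x x, jWeight x e ≤ ∑ j, minSpoke x j := by
  refine (Finset.sum_le_sum_of_subset (jCand_subset_image_jParent x)).trans ?_
  refine (sum_image_le_sum _ _ _).trans ?_
  refine (Finset.sum_le_sum_of_subset (Finset.erase_subset _ _)).trans ?_
  rw [Fintype.sum_sum_type, Fintype.sum_prod_type]
  have h1 : ∀ a : Fin (m + 1), jWeight x s(Sum.inl a, jParent x (Sum.inl a)) = 0 := fun a => rfl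
  simp only [h1, Finset.sum_const_zero, zero_add]
  refine Finset.sum_le_sum fun j _ => ?_
  cases hx : x j with
  | true =>
    have : ∀ z : Fin (m ^ 2 + 1), jWeight x s(Sum.inr (j, z), jParent x (Sum.inr (j, z))) =
        if z = 0 then 1 else 0 := by
      intro z
      by_cases hz : z = 0
      · simp [jParent, hx, hz, hwy, jWeight, jWeightFun, spokeWeight]
      · simp [jParent, hx, hz, lane, jWeight, jWeightFun]
    simp [this, minSpoke, hx]
  | false =>
    have : ∀ z : Fin (m ^ 2 + 1), jWeight x s(Sum.inr (j, z), jParent x (Sum.inr (j, z))) =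
        if z = Fin.last _ then 2 else 0 := by
      intro z
      by_cases hz : z = Fin.last _
      · have : m ≠ 0 := by omega
        simp [jParent, hx, hz, hwy, jWeight, jWeightFun, spokeWeight, Fin.ofNat, this]
      · have : (z : ℕ) ≠ m ^ 2 := fun h => hz (Fin.ext h)
        simp [jParent, hx, hz, lane, jWeight, jWeightFun, this]
    simp [this, minSpoke, hx]

end Family

/-! ### Hard instances on extensions of `FGraph m` -/

section Instances

variable {V : Type} [Fintype V] {m : ℕ} {N : Network V}

open Classical in
/-- The candidate of an extension of `F²ₘ`. -/
noncomputable def extCand {G : SimpleGraph V} (E : RootedExtension (FGraph m) (hwy m 0) G)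
    (x y : Fin (m ^ 2) → Bool) : Finset (Sym2 V) :=
  E.tree ∪ (jCand x y).image (Sym2.map E.emb)

/-- The weights of an extension of `F²ₘ`. -/
def extWeight {G : SimpleGraph V} (E : RootedExtension (FGraph m) (hwy m 0) G)
    (x : Fin (m ^ 2) → Bool) (e : Sym2 V) : ℕ :=
  jWeight x (e.map E.retr)

theorem RootedExtension.map_retr_map_emb {U V : Type} [Fintype U] [Fintype V] {F : SimpleGraph U}
    {r : U} {G : SimpleGraph V} (E : RootedExtension F r G) (e : Sym2 U) :
    (e.map E.emb).map E.retr = e := by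
  rw [Sym2.map_map, show E.retr ∘ E.emb = id from funext E.retr_emb, Sym2.map_id, id]

variable {G : SimpleGraph V} (E : RootedExtension (FGraph m) (hwy m 0) G)

theorem mem_extCand {x y : Fin (m ^ 2) → Bool} {e : Sym2 V} :
    e ∈ extCand E x y ↔
      e ∈ E.tree ∨ e.map E.retr ∈ jCand x y ∧ (e.map E.retr).map E.emb = e := by
  classical
  simp only [extCand, Finset.mem_union, Finset.mem_image]
  refine or_congr_right ⟨?_, fun ⟨h, h'⟩ => ⟨_, h, h'⟩⟩
  rintro ⟨e, he, rfl⟩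
  rw [E.map_retr_map_emb]
  exact ⟨he, rfl⟩

theorem extCand_subset (x y : Fin (m ^ 2) → Bool) :
    (extCand E x y : Set (Sym2 V)) ⊆ G.edgeSet := by
  intro e he
  rcases (mem_extCand E).1 he with h | ⟨h, h'⟩
  · exact E.tree_subset h
  · rw [← h']
    have hF := jCand_subset x y h
    revert hF
    induction e.map E.retr using Sym2.ind with
    | _ a b => exact fun hF => E.adj_emb a b hF

/-- The instances on an extension of `F²ₘ`. -/
noncomputable def extInstance (N : Network V) (E : RootedExtension (FGraph m) (hwy m 0) N.graph)
    (S : Set V) (x y : Fin (m ^ 2) → Bool) : Instance V where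
  net := N
  weight := extWeight E x
  cand := extCand E x y
  cand_subset := extCand_subset E x y
  awake := S

/-- A connected spanning subgraph has an edge that joins the `j`-th path to the highway. -/
theorem exists_spoke_mem {T : Finset (Sym2 V)} (hT : (T : Set (Sym2 V)) ⊆ G.edgeSet)
    (hconn : (SimpleGraph.fromEdgeSet (T : Set (Sym2 V))).Connected) (j : Fin (m ^ 2)) :
    ∃ e ∈ T, ∃ a z, e.map E.retr = s(Sum.inl a, Sum.inr (j, z)) := by
  obtain ⟨p⟩ := hconn.preconnected (E.emb (lane m j 0)) (E.emb (hwy m 0))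
  obtain ⟨d, -, ⟨z, hz⟩, hd⟩ := p.exists_boundary_dart {v | ∃ z, E.retr v = Sum.inr (j, z)}
    ⟨Fin.ofNat _ 0, E.retr_emb _⟩ (by simp [E.retr_emb, hwy])
  have hmem : s(d.fst, d.snd) ∈ T := ((SimpleGraph.fromEdgeSet_adj _).1 d.adj).1
  refine ⟨_, hmem, ?_⟩
  -- The edge by which the walk leaves the path is not in the attached part, since that part
  -- retracts to the highway; so it comes from `FGraph m`, where paths are left only by spokes.
  rcases E.adj_cases _ _ (hT hmem) with ⟨h, -⟩ | ⟨-, -, h⟩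
  · rw [hz] at h
    simp [hwy] at h
  · rw [hz] at h
    rw [Sym2.map_mk, hz]
    rcases hw : E.retr d.snd with a | ⟨k, y⟩
    · exact ⟨a, z, Sym2.eq_swap⟩
    · refine (hd ⟨y, ?_⟩).elim
      rw [hw] at h ⊢
      rcases (FGraph_adj_iff.1 h).2 with h | h
      · rw [h.1]
      · rw [h.1]

/-- Connectedness plus the upper bound `|V| - 1` on the number of edges; the reverse inequality is
automatic for connected graphs. -/
theorem isSpanningTree_extCand (x : Fin (m ^ 2) → Bool) :
    IsSpanningTree G (extCand E x x) := by
  classical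
  refine ⟨extCand_subset E x x, ?_⟩
  have hconn : (SimpleGraph.fromEdgeSet (extCand E x x : Set (Sym2 V))).Connected := by
    have h1 : ∀ v, (SimpleGraph.fromEdgeSet (extCand E x x : Set (Sym2 V))).Reachable v
        (E.emb (E.retr v)) := fun v =>
      (E.tree_reachable v).mono (SimpleGraph.fromEdgeSet_mono (by
        simp only [extCand, Finset.coe_union]
        exact Set.subset_union_left))
    let φ : SimpleGraph.fromEdgeSet (jCand x x : Set (Sym2 (FVert m))) →g
        SimpleGraph.fromEdgeSet (extCand E x x : Set (Sym2 V)) := ⟨E.emb, fun {a b} h => by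
      rw [SimpleGraph.fromEdgeSet_adj] at h ⊢
      refine ⟨?_, fun hab => h.2 ?_⟩
      · simp only [extCand, Finset.coe_union, Finset.coe_image]
        exact .inr ⟨_, h.1, rfl⟩
      · rw [← E.retr_emb a, hab, E.retr_emb]⟩
    have : Nonempty V := ⟨E.emb (hwy m 0)⟩
    refine ⟨fun v w => (h1 v).trans (.trans ?_ (h1 w).symm)⟩
    exact ((jCand_connected x).preconnected _ _).map φ
  refine SimpleGraph.isTree_iff_connected_and_card.2 ⟨hconn, le_antisymm ?_
    hconn.card_vert_le_card_edgeSet_add_one⟩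
  have hE := card_edgeSet_fromEdgeSet (extCand_subset E x x)
  have h1 := card_jCand_lt x
  have h2 := E.tree_card
  have h3 : (extCand E x x).card ≤ E.tree.card + (jCand x x).card :=
    (Finset.card_union_le _ _).trans (Nat.add_le_add_left Finset.card_image_le _)
  rw [Nat.card_eq_fintype_card (α := V)]
  omega

/-- Every spanning tree contains a spoke of each path, these spokes are distinct, and each costs at
least `minSpoke`. The candidate attains the resulting bound. -/
theorem isMST_extCand (hm : 1 ≤ m) (x : Fin (m ^ 2) → Bool) :
    IsMST G (extWeight E x) (extCand E x x) := by
  classical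
  refine ⟨isSpanningTree_extCand E x, fun T hT => ?_⟩
  have hupper : ∑ e ∈ extCand E x x, extWeight E x e ≤ ∑ j, minSpoke x j := by
    -- Attached edges retract to the pair `s(r, r)` of highway vertices, which has weight 0.
    have h1 : ∑ e ∈ E.tree, extWeight E x e = 0 := Finset.sum_eq_zero fun e he => by
      rw [extWeight, E.map_tree e he]
      rfl
    have h2 : ∑ e ∈ (jCand x x).image (Sym2.map E.emb), extWeight E x e ≤ ∑ j, minSpoke x j := by
      refine (sum_image_le_sum _ _ _).trans ?_
      simp only [extWeight, E.map_retr_map_emb]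
      exact sum_jCand_le hm x
    have h3 := Finset.sum_union_inter (s₁ := E.tree) (s₂ := (jCand x x).image (Sym2.map E.emb))
      (f := extWeight E x)
    rw [extCand]
    omega
  refine hupper.trans ?_
  choose e he a z hez using exists_spoke_mem E hT.1 hT.2.connected
  have hinj : Function.Injective e := by
    intro j k hjk
    have h := hez j
    rw [hjk, hez k] at h
    simp at h
    exact h.2.1.symm
  calc ∑ j, minSpoke x j ≤ ∑ j, extWeight E x (e j) := Finset.sum_le_sum fun j _ => by
        rw [extWeight, hez]
        exact minSpoke_le x _ j _
    _ = ∑ f ∈ Finset.univ.image e, extWeight E x f := by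
        rw [Finset.sum_image fun j _ k _ h => hinj h]
    _ ≤ ∑ f ∈ T, extWeight E x f := Finset.sum_le_sum_of_subset fun f hf => by
        obtain ⟨j, -, rfl⟩ := Finset.mem_image.1 hf
        exact he j

/-- With these bits neither the first nor the last spoke of path `j` is marked, and inner spokes
never are. The weights are irrelevant. -/
theorem not_isMST_extCand {ω : Sym2 V → ℕ} {x y : Fin (m ^ 2) → Bool} {j : Fin (m ^ 2)}
    (hx : x j = false) (hy : y j = true) : ¬ IsMST G ω (extCand E x y) := by
  intro h
  obtain ⟨e, he, a, z, hez⟩ := exists_spoke_mem E h.1.1 h.1.2.connected j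
  rcases (mem_extCand E).1 he with h | ⟨h, -⟩
  · rw [E.map_tree e h] at hez
    simp [hwy] at hez
  · rw [hez, mk_mem_jCand] at h
    simp [jMarkFun, hx, hy] at h

theorem not_isMST_or {x y : Fin (m ^ 2) → Bool} (hxy : x ≠ y) {ω ω' : Sym2 V → ℕ} :
    ¬ IsMST G ω (extCand E x y) ∨ ¬ IsMST G ω' (extCand E y x) := by
  obtain ⟨j, hj⟩ := Function.ne_iff.1 hxy
  cases hx : x j <;> cases hy : y j <;> simp only [hx, hy, ne_eq, not_true] at hj
  · exact .inl (not_isMST_extCand E hx hy)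
  · exact .inr (not_isMST_extCand E hy hx)

theorem pos_hwy {i : ℕ} (hi : i ≤ m) : pos m (hwy m i) = i * m := by
  simp [pos, hwy, Fin.ofNat, Nat.mod_eq_of_lt (Nat.lt_succ_of_le hi)]

/-- Only a highway edge can jump from position `≤ t` to beyond `t + 1`, and the one that does starts
at `hwy m (t / m)`. -/
theorem FGraph_adj_right {v w : FVert m} (h : (FGraph m).Adj v w) {t : ℕ} (ht : t + 1 < pos m v) :
    t < pos m w ∨ v = hwy m (t / m + 1) ∧ w = hwy m (t / m) := by
  rcases (FGraph_adj_iff.1 h).2 with h | h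
  · have := h.pos_cases.1
    omega
  · rcases h.pos_cases with ⟨-, h | ⟨i, -, hw, hv, hpw, hpv⟩⟩
    · omega
    · by_cases hlt : t < pos m w
      · exact .inl hlt
      · have : t / m = i := Nat.div_eq_of_lt_le (by omega) (by omega)
        exact .inr ⟨by rw [this, hv], by rw [this, hw]⟩

theorem FGraph_adj_left {v w : FVert m} (h : (FGraph m).Adj v w) {t : ℕ}
    (ht : pos m v + (t + 1) < m ^ 2) :
    pos m w + t < m ^ 2 ∨ v = hwy m (m - 1 - t / m) ∧ w = hwy m (m - t / m) := by
  rcases (FGraph_adj_iff.1 h).2 with h | h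
  · rcases h.pos_cases with ⟨-, h | ⟨i, hi, hv, hw, hpv, hpw⟩⟩
    · omega
    · by_cases hlt : pos m w + t < m ^ 2
      · exact .inl hlt
      · obtain ⟨d, rfl⟩ : ∃ d, m = i + 1 + d := ⟨m - (i + 1), by omega⟩
        have : t / (i + 1 + d) = d := by
          apply Nat.div_eq_of_lt_le
          · rw [hpw] at hlt
            nlinarith
          · rw [hpv] at ht
            nlinarith
        rw [this, show i + 1 + d - 1 - d = i by omega, show i + 1 + d - d = i + 1 by omega]
        exact .inr ⟨hv, hw⟩
  · have := h.pos_cases.1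
    omega

/-- The bound `2 * T ≤ m ^ 2` keeps the sender of each critical message inside the opposite region,
where its state is known. Attached vertices have position 0: they never lie on the right and are
never separated on the left. -/
theorem narrowCut_extension {T : ℕ} (hT : 2 * T ≤ m ^ 2) :
    NarrowCut G T (fun t => {v | t < pos m (E.retr v)})
      (fun t => {v | pos m (E.retr v) + t < m ^ 2})
      (fun t => E.emb (hwy m (t / m + 1))) (fun t => E.emb (hwy m (t / m)))
      (fun t => E.emb (hwy m (m - 1 - t / m))) (fun t => E.emb (hwy m (m - t / m))) where
  right_sub t _ v hv := by simp only [Set.mem_ofPred_eq] at *; omega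
  left_sub t _ v hv := by simp only [Set.mem_ofPred_eq] at *; omega
  right_adj t ht v hv w hvw := by
    simp only [Set.mem_ofPred_eq] at *
    rcases E.adj_cases v w hvw with ⟨h, -⟩ | ⟨h1, h2, h⟩
    · rw [h, pos_hwy (Nat.zero_le _), zero_mul] at hv
      omega
    · rcases FGraph_adj_right h hv with h | ⟨h3, h4⟩
      · exact .inl h
      · exact .inr ⟨by rw [← h3, h1], by rw [← h4, h2]⟩
  left_adj t ht v hv w hvw := by
    simp only [Set.mem_ofPred_eq] at *
    rcases E.adj_cases v w hvw with ⟨h, h'⟩ | ⟨h1, h2, h⟩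
    · rw [h] at hv
      rw [h']
      omega
    · rcases FGraph_adj_left h hv with h | ⟨h3, h4⟩
      · exact .inl h
      · exact .inr ⟨by rw [← h3, h1], by rw [← h4, h2]⟩
  right_source t ht := by
    have h1 : t / m < m := Nat.div_lt_of_lt_mul (by rw [← sq]; omega)
    have h2 := Nat.div_mul_le_self t m
    simp only [Set.mem_ofPred_eq, E.retr_emb, pos_hwy h1.le]
    omega
  left_source t ht := by
    have h1 : t / m < m := Nat.div_lt_of_lt_mul (by rw [← sq]; omega)
    have h2 := Nat.div_mul_le_self t m
    simp only [Set.mem_ofPred_eq, E.retr_emb, pos_hwy (Nat.sub_le m _), Nat.sub_mul, ← sq]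
    omega

theorem localInput_extInstance_right (E : RootedExtension (FGraph m) (hwy m 0) N.graph) {S : Set V}
    {v : V} (hv : 0 < pos m (E.retr v)) (x x' y : Fin (m ^ 2) → Bool) :
    (extInstance N E S x y).localInput v = (extInstance N E S x' y).localInput v := by
  refine Instance.localInput_congr (N := N) rfl rfl fun w hvw => ⟨?_, ?_⟩
  · simp only [extInstance, extWeight, Sym2.map_mk]
    rcases E.adj_cases v w hvw with ⟨h, -⟩ | ⟨-, -, h⟩
    · simp [h, pos_hwy] at hv
    · exact jWeight_congr hv h
  · simp only [extInstance, mem_extCand, Sym2.map_mk, mem_jCand_congr_left (x' := x') hv]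

theorem localInput_extInstance_left (E : RootedExtension (FGraph m) (hwy m 0) N.graph) {S : Set V}
    {v : V} (hv : pos m (E.retr v) < m ^ 2) (x y y' : Fin (m ^ 2) → Bool) :
    (extInstance N E S x y).localInput v = (extInstance N E S x y').localInput v := by
  refine Instance.localInput_congr (N := N) rfl rfl fun w hvw => ⟨rfl, ?_⟩
  simp only [extInstance, mem_extCand, Sym2.map_mk, mem_jCand_congr_right (y' := y') hv]

/-- A time `T` below the bound means `4BT < m²`, whereas the fooling set of size `2 ^ m ^ 2` forces
`m² ≤ 2T(B + 1) ≤ 4BT`. -/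
theorem exists_needsTime_cut (hm : 1 ≤ m) {B : ℕ} (hB : 1 ≤ B) {A : Algorithm.{u}}
    (E : RootedExtension (FGraph m) (hwy m 0) N.graph) (S : Set V)
    (hA : ∀ x y, A.Verifies (extInstance N E S x y) B) :
    ∃ x y, A.NeedsTime (extInstance N E S x y) (1 / 4 * ((m : ℝ) ^ 2 / B)) := by
  by_contra! hcon
  obtain ⟨T, hTx, hT⟩ := Algorithm.exists_solvesBy_of_forall_not_needsTime
    (I := fun p : (Fin (m ^ 2) → Bool) × (Fin (m ^ 2) → Bool) => extInstance N E S p.1 p.2)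
    fun p => hcon p.1 p.2
  have hlt : 4 * B * T < m ^ 2 := by
    have hB' : (0 : ℝ) < B := by exact_mod_cast hB
    have h1 : (T : ℝ) * (4 * B) < m ^ 2 := by
      rw [show 1 / 4 * ((m : ℝ) ^ 2 / B) = m ^ 2 / (4 * B) by field_simp] at hTx
      exact (lt_div_iff₀ (by positivity)).1 hTx
    have h2 : T * (4 * B) < m ^ 2 := by exact_mod_cast h1
    rwa [mul_comm] at h2
  have hBT : T ≤ B * T := Nat.le_mul_of_pos_left T hB
  have hcard := (narrowCut_extension E (T := T) (by nlinarith)).card_le (A := A) (B := B)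
    (X := Fin (m ^ 2) → Bool) (I := extInstance N E S) (S := S)
    ⟨E.emb (hwy m m), by
      simp only [Set.mem_ofPred_eq, E.retr_emb, pos_hwy le_rfl, ← sq]
      nlinarith⟩
    (fun _ _ => rfl) (fun _ _ => rfl)
    (fun v hv => localInput_extInstance_left E (by simpa using hv))
    (fun v hv => localInput_extInstance_right E hv)
    (isMST_extCand E hm) (fun x y hxy => not_isMST_or E hxy) (fun x y => hT (x, y))
    (fun x => (hA x x).2)
  simp only [Fintype.card_fun, Fintype.card_bool, Fintype.card_fin] at hcard
  have := (Nat.pow_le_pow_iff_right (by norm_num)).1 hcard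
  nlinarith

end Instances

/-! ### Legal instances with prescribed order and diameter -/

section Bounds

open Classical in
/-- A network on a given finite graph, with identifiers below the number of vertices. -/
noncomputable def stdNetwork {V : Type} [Fintype V] (G : SimpleGraph V) : Network V where
  graph := G
  ident v := Fintype.equivFin V v
  ident_injective _ _ h := (Fintype.equivFin V).injective (Fin.ext h)
  deg v := Fintype.card (G.neighborSet v)
  port v := (Fintype.equivFin (G.neighborSet v)).symm

theorem StartMode.exists_allows (mode : StartMode) (V : Type) [Nonempty V] :
    ∃ S : Set V, mode.Allows S := by
  cases mode
  · exact ⟨Set.univ, rfl⟩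
  · exact ⟨{Classical.arbitrary V}, Classical.arbitrary V, rfl⟩

theorem Instance.legal_of_stdNetwork {V : Type} [Fintype V] {G : SimpleGraph V} {I : Instance V}
    {mode : StartMode} {κ n : ℕ} (hI : I.net = stdNetwork G) (hn : Fintype.card V = n)
    (hG : G.Connected) (hκ : 1 ≤ κ) (hw : ∀ e ∈ G.edgeSet, I.weight e ≤ n ^ κ)
    (hmode : mode.Allows I.awake) : I.Legal mode κ n := by
  refine ⟨hn, by rwa [hI], fun v => ?_, by rwa [hI], hmode⟩
  rw [hI, ← hn]
  exact (Fin.is_lt _).le.trans (Nat.le_self_pow (by omega) _)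

theorem Algorithm.NeedsTime.mono {V : Type} [Fintype V] {A : Algorithm.{u}} {I : Instance V}
    {x y : ℝ} (h : A.NeedsTime I y) (hxy : x ≤ y) : A.NeedsTime I x :=
  fun T hT => hxy.trans (h T hT)

theorem Algorithm.Verifies.mono {V : Type} [Fintype V] {A : Algorithm.{u}} {I : Instance V}
    {B B' : ℕ} (h : A.Verifies I B) (hB : B ≤ B') : A.Verifies I B' :=
  ⟨h.1, fun t v p hp msg hmsg => (h.2 t v p hp msg hmsg).trans hB⟩

theorem exists_legal_needsTime_diam (mode : StartMode) {κ n D : ℕ} (A : Algorithm.{u})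
    (hκ : 1 ≤ κ) (hD : 2 ≤ D) (hDn : D + 1 ≤ n) :
    ∃ (V : Type) (_ : Fintype V) (I : Instance V), I.Legal mode κ n ∧
      I.net.graph.diam = D ∧ A.NeedsTime I (1 / 2 * D) := by
  have hF : (⊤ : SimpleGraph Bool).Connected := SimpleGraph.connected_top
  -- A single edge with a path of `D - 1` vertices attached has diameter `D`; the remaining vertices
  -- become leaves.
  let G := tailGraph (⊤ : SimpleGraph Bool) false (n - 2) (D - 1)
  have hconn : G.Connected := tailGraph_connected hF (by omega)
  have hdist : ∀ a b, (⊤ : SimpleGraph Bool).dist a b ≤ 1 := fun a b => by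
    rw [SimpleGraph.dist_top]
    split_ifs <;> omega
  have hdiam : G.diam = D := by
    rw [show D = 1 + (D - 1) by omega]
    exact tailGraph_diam hF (by omega) (by omega) le_rfl (hdist false) (z := true)
      (by simp [SimpleGraph.dist_top]) fun a b => (hdist a b).trans (by omega)
  have hcard : Fintype.card (Bool ⊕ Fin (n - 2)) = n := by
    simp only [Fintype.card_sum, Fintype.card_bool, Fintype.card_fin]
    omega
  obtain ⟨S, hS⟩ := mode.exists_allows (Bool ⊕ Fin (n - 2))
  obtain ⟨I, hI, haw, hw, hneeds⟩ := exists_needsTime_diam (stdNetwork G) S κ A hconn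
    (by rw [show (stdNetwork G).graph = G from rfl, hdiam]; exact hD)
  rw [show (stdNetwork G).graph = G from rfl] at hw hneeds
  refine ⟨_, _, I, Instance.legal_of_stdNetwork hI hcard hconn hκ ?_ (haw ▸ hS), ?_, ?_⟩
  · rwa [hcard] at hw
  · rw [hI]
    exact hdiam
  · rwa [hdiam] at hneeds

theorem exists_legal_needsTime_cut (mode : StartMode) {κ n D B m : ℕ} (A : Algorithm.{u})
    (hκ : 1 ≤ κ) (hB : 1 ≤ B) (hm : 1 ≤ m) (hD : 4 * m + 1 ≤ D) (hn : 4 * m ^ 4 + D ≤ n)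
    (hA : ∀ (V : Type) [Fintype V] (I : Instance V), I.Legal mode κ n →
      I.net.graph.diam = D → A.Verifies I B) :
    ∃ (V : Type) (_ : Fintype V) (I : Instance V), I.Legal mode κ n ∧
      I.net.graph.diam = D ∧ A.NeedsTime I (1 / 4 * ((m : ℝ) ^ 2 / B)) := by
  have hF := FGraph_connected hm
  obtain ⟨z, hz⟩ := Finite.exists_max fun a => (FGraph m).dist (hwy m 0) a
  obtain ⟨e, he⟩ : ∃ e, (FGraph m).dist (hwy m 0) z = e := ⟨_, rfl⟩
  rw [he] at hz
  have he1 : 1 ≤ e := by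
    have h := hz (hwy m 1)
    rwa [SimpleGraph.dist_eq_one_iff_adj.2 (FGraph_adj_hwy hm)] at h
  have he4 : e ≤ 4 * m := he ▸ FGraph_dist_le hm _ _
  have hcardF := card_FVert_le hm
  have hcard : Fintype.card (FVert m ⊕ Fin (n - Fintype.card (FVert m))) = n := by
    rw [Fintype.card_sum, Fintype.card_fin]
    omega
  -- `e` is the eccentricity of the root; from `e ≤ 4m < D` the attached path is nonempty.
  let G := tailGraph (FGraph m) (hwy m 0) (n - Fintype.card (FVert m)) (D - e)
  have hconn : G.Connected := tailGraph_connected hF (by omega)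
  have hdiam : G.diam = D := by
    rw [show D = e + (D - e) by omega]
    exact tailGraph_diam hF (by omega) (by omega) he1 hz he fun a b =>
      (FGraph_dist_le hm a b).trans (by omega)
  have := hconn.nonempty
  obtain ⟨S, hS⟩ := mode.exists_allows (FVert m ⊕ Fin (n - Fintype.card (FVert m)))
  let E : RootedExtension (FGraph m) (hwy m 0) (stdNetwork G).graph := tailExtension
  have hlegal : ∀ x y, (extInstance (stdNetwork G) E S x y).Legal mode κ n := fun x y =>
    Instance.legal_of_stdNetwork rfl hcard hconn hκ (fun e _ => (jWeight_le x _).trans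
      ((show 4 ≤ n by omega).trans (Nat.le_self_pow (by omega) n))) hS
  obtain ⟨x, y, h⟩ := exists_needsTime_cut hm hB E S fun x y => hA _ _ (hlegal x y) hdiam
  exact ⟨_, _, _, hlegal x y, hdiam, h⟩

theorem exists_needsTime_sqrt_add_diam (mode : StartMode) {κ n D B : ℕ} (A : Algorithm.{u})
    (hκ : 1 ≤ κ) (hB : 1 ≤ B) (hD : 10 * (n : ℝ) ^ (1 / 4 : ℝ) ≤ D) (hDn : D + 1 ≤ n)
    (hA : ∀ (V : Type) [Fintype V] (I : Instance V), I.Legal mode κ n →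
      I.net.graph.diam = D → A.Verifies I B) :
    ∃ (V : Type) (_ : Fintype V) (I : Instance V), I.Legal mode κ n ∧
      I.net.graph.diam = D ∧ A.NeedsTime I (1 / 128 * (√n / B + D)) := by
  obtain ⟨s, hs⟩ : ∃ s, (n : ℝ) ^ (1 / 4 : ℝ) = s := ⟨_, rfl⟩
  have hs1 : 1 ≤ s := by
    rw [← hs]
    exact Real.one_le_rpow (by exact_mod_cast (by omega : 1 ≤ n)) (by norm_num)
  have hs4 : s ^ 4 = n := by
    rw [← hs, ← Real.rpow_natCast, ← Real.rpow_mul (Nat.cast_nonneg n)]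
    norm_num
  have hs2 : √n = s ^ 2 := by
    rw [← hs4, show s ^ 4 = (s ^ 2) ^ 2 by ring, Real.sqrt_sq (by positivity)]
  rw [hs] at hD
  have hB' : (1 : ℝ) ≤ B := by exact_mod_cast hB
  -- Either way half of the sum is dominated: the constant is at most `1/2 · 1/2` if `D` is larger,
  -- and equals `1/2 · 1/4 · 1/16` otherwise, with `1/16` lost in `m ≥ s / 4`.
  by_cases hcase : √n / B ≤ D
  · have h2 : 2 ≤ D := by
      have : (2 : ℝ) ≤ D := by linarith
      exact_mod_cast this
    obtain ⟨V, _, I, h1, h3, h4⟩ := exists_legal_needsTime_diam mode A hκ h2 hDn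
    refine ⟨V, _, I, h1, h3, h4.mono ?_⟩
    have : (0 : ℝ) ≤ D := Nat.cast_nonneg D
    linarith
  · push Not at hcase
    have hDs : (D : ℝ) < s ^ 2 := by
      rw [hs2] at hcase
      exact hcase.trans_le (div_le_self (by positivity) hB')
    -- From `10s ≤ D < s²`. With `m = ⌊s/2⌋` this leaves room for everything: `4m⁴ ≤ n/4`, `D < s² ≤
    -- n/100` and `4m + 1 ≤ 10s ≤ D`.
    have hs10 : 10 < s := by nlinarith
    have hmle : (⌊s / 2⌋₊ : ℝ) ≤ s / 2 := Nat.floor_le (by positivity)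
    have hmlt : s / 2 - 1 < ⌊s / 2⌋₊ := Nat.sub_one_lt_floor _
    have hm4 : s / 4 ≤ (⌊s / 2⌋₊ : ℝ) := by linarith
    obtain ⟨V, _, I, h1, h3, h4⟩ := exists_legal_needsTime_cut mode (m := ⌊s / 2⌋₊) A hκ hB
      (by
        have : (1 : ℝ) ≤ ⌊s / 2⌋₊ := by linarith
        exact_mod_cast this)
      (by
        have : (4 * ⌊s / 2⌋₊ + 1 : ℝ) ≤ D := by linarith
        exact_mod_cast this)
      (by
        have h1 : (⌊s / 2⌋₊ : ℝ) ^ 4 ≤ (s / 2) ^ 4 := pow_le_pow_left₀ (by positivity) hmle 4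
        have h2 : (4 * ⌊s / 2⌋₊ ^ 4 + D : ℝ) ≤ n := by
          rw [← hs4]
          have h3 : 100 * s ^ 2 ≤ s ^ 4 := by
            have : 100 ≤ s ^ 2 := by nlinarith
            nlinarith [sq_nonneg s]
          have h4 : (s / 2) ^ 4 = s ^ 4 / 16 := by ring
          nlinarith [sq_nonneg s]
        exact_mod_cast h2) hA
    refine ⟨V, _, I, h1, h3, h4.mono ?_⟩
    have h5 : s ^ 2 / 16 ≤ (⌊s / 2⌋₊ : ℝ) ^ 2 := by
      have := pow_le_pow_left₀ (by positivity) hm4 2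
      nlinarith
    have h6 : s ^ 2 / 16 / B ≤ (⌊s / 2⌋₊ : ℝ) ^ 2 / B :=
      div_le_div_of_nonneg_right h5 (by positivity)
    have h7 : s ^ 2 / 16 / B = √n / B / 16 := by rw [hs2]; ring
    linarith

end Bounds

end Congest

/-! ### The theorem: assembling the six bounds -/

theorem theorem3 :
    -- the graphs `F²ₘ` have `Θ(m⁴)` vertices and diameter `Θ(m)`
    (∃ c C : ℝ, 0 < c ∧ ∀ m : ℕ, 1 ≤ m → (FGraph m).Connected ∧
      c * (m : ℝ) ^ 4 ≤ Fintype.card (FVert m) ∧ Fintype.card (FVert m) ≤ C * (m : ℝ) ^ 4 ∧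
      c * m ≤ (FGraph m).diam ∧ (FGraph m).diam ≤ C * m) ∧
    -- verification on the family `𝒥²ₘ` needs `Ω(m² / B)` rounds, whatever the identifiers, the
    -- port numbering and the set of initially awake vertices are
    (∃ c : ℝ, 0 < c ∧ ∀ m B : ℕ, 1 ≤ m → 1 ≤ B →
      ∀ (N : Network (FVert m)) (S : Set (FVert m)) (A : Algorithm.{u}), N.graph = FGraph m →
        (∀ I : Instance (FVert m), I.net = N → I.awake = S → IsJWeight m I.weight →
          A.Verifies I B) →
        ∃ I : Instance (FVert m), I.net = N ∧ I.awake = S ∧ IsJWeight m I.weight ∧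
          A.NeedsTime I (c * ((m : ℝ) ^ 2 / B))) ∧
    -- verification needs `Ω(√n / B)` rounds on some `n`-vertex graphs of diameter `O(n^{1/4})`
    (∃ (c C : ℝ) (n₀ : ℕ), 0 < c ∧
      ∀ (mode : StartMode) (κ n B : ℕ) (A : Algorithm.{u}), 1 ≤ κ → n₀ ≤ n → 1 ≤ B →
        (∀ (V : Type) [Fintype V] (I : Instance V), I.Legal mode κ n →
          I.net.graph.diam ≤ C * (n : ℝ) ^ (1 / 4 : ℝ) → A.Verifies I B) →
        ∃ (V : Type) (_ : Fintype V) (I : Instance V), I.Legal mode κ n ∧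
          I.net.graph.diam ≤ C * (n : ℝ) ^ (1 / 4 : ℝ) ∧ A.NeedsTime I (c * (√n / B))) ∧
    -- verification needs `Ω(D)` rounds on every network of diameter `D ≥ 2`
    (∃ c : ℝ, 0 < c ∧
      ∀ (V : Type) [Fintype V] (N : Network V) (S : Set V) (κ : ℕ) (A : Algorithm.{u}),
        N.graph.Connected → 2 ≤ N.graph.diam →
        (∀ I : Instance V, I.net = N → I.awake = S →
          (∀ e ∈ N.graph.edgeSet, I.weight e ≤ Fintype.card V ^ κ) → ∃ T, A.SolvesBy I T) →
        ∃ I : Instance V, I.net = N ∧ I.awake = S ∧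
          (∀ e ∈ N.graph.edgeSet, I.weight e ≤ Fintype.card V ^ κ) ∧
          A.NeedsTime I (c * N.graph.diam)) ∧
    -- verification needs `Ω(√n / B + D)` rounds on some `n`-vertex graph of diameter `D`, for all
    -- `n` and `D` with `C n^{1/4} ≤ D ≤ n - 1`
    (∃ c C : ℝ, 0 < c ∧ 0 < C ∧
      ∀ (mode : StartMode) (κ n D B : ℕ) (A : Algorithm.{u}), 1 ≤ κ → 1 ≤ B →
        C * (n : ℝ) ^ (1 / 4 : ℝ) ≤ D → D + 1 ≤ n →
        (∀ (V : Type) [Fintype V] (I : Instance V), I.Legal mode κ n →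
          I.net.graph.diam = D → A.Verifies I B) →
        ∃ (V : Type) (_ : Fintype V) (I : Instance V), I.Legal mode κ n ∧
          I.net.graph.diam = D ∧ A.NeedsTime I (c * (√n / B + D))) ∧
    -- hence `Ω̃(√n + D)` rounds if messages have `O(log n)` bits
    (∃ C : ℝ, 0 < C ∧ ∀ K : ℝ, ∃ c : ℝ, 0 < c ∧
      ∀ (mode : StartMode) (κ n D B : ℕ) (A : Algorithm.{u}), 1 ≤ κ → B ≤ K * Real.log n →
        C * (n : ℝ) ^ (1 / 4 : ℝ) ≤ D → D + 1 ≤ n →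
        (∀ (V : Type) [Fintype V] (I : Instance V), I.Legal mode κ n →
          I.net.graph.diam = D → A.Verifies I B) →
        ∃ (V : Type) (_ : Fintype V) (I : Instance V), I.Legal mode κ n ∧
          I.net.graph.diam = D ∧ A.NeedsTime I (c * ((√n + D) / Real.log n))) := by
  refine ⟨⟨1, 4, one_pos, fun m hm => ⟨FGraph_connected hm, ?_, ?_, ?_, ?_⟩⟩,
    ⟨1 / 4, by norm_num, ?_⟩, ⟨1 / 128, 11, 81, by norm_num, ?_⟩, ⟨1 / 2, by norm_num, ?_⟩,
    ⟨1 / 128, 10, by norm_num, by norm_num, ?_⟩, ⟨10, by norm_num, fun K => ?_⟩⟩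
  · rw [card_FVert, one_mul]
    exact_mod_cast (by omega : m ^ 4 ≤ m ^ 4 + m ^ 2 + m + 1)
  · exact_mod_cast card_FVert_le hm
  · rw [one_mul]
    exact_mod_cast le_FGraph_diam hm
  · exact_mod_cast FGraph_diam_le hm
  · intro m B hm hB N S A hN hA
    have hJ : ∀ x, IsJWeight m (extWeight (RootedExtension.refl (hwy m 0) hN) x) := fun x => by
      have : extWeight (RootedExtension.refl (hwy m 0) hN) x = jWeight x := by
        funext e
        simp [extWeight, RootedExtension.refl]
      rw [this]
      exact isJWeight_jWeight hm x
    obtain ⟨x, y, h⟩ := exists_needsTime_cut hm hB (RootedExtension.refl (hwy m 0) hN) S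
      fun x y => hA _ rfl rfl (hJ x)
    exact ⟨_, rfl, rfl, hJ x, h⟩
  · intro mode κ n B A hκ hn hB hA
    obtain ⟨s, hs⟩ : ∃ s, (n : ℝ) ^ (1 / 4 : ℝ) = s := ⟨_, rfl⟩
    have hs0 : 0 ≤ s := hs ▸ Real.rpow_nonneg (Nat.cast_nonneg n) _
    have hs4 : s ^ 4 = n := by
      rw [← hs, ← Real.rpow_natCast, ← Real.rpow_mul (Nat.cast_nonneg n)]
      norm_num
    -- Here `81 = 3⁴`; then `s⁴ ≥ 27s` exceeds `⌈10s⌉ + 1`, so the diameter `⌈10s⌉` is admissible,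
    -- and it is at most `11s`.
    have hs3 : 3 ≤ s := by
      refine le_of_pow_le_pow_left₀ (n := 4) (by norm_num) hs0 ?_
      rw [hs4]
      norm_num
      exact_mod_cast hn
    have hceil : (⌈10 * s⌉₊ : ℝ) < 10 * s + 1 := Nat.ceil_lt_add_one (by positivity)
    have hdiam : (⌈10 * s⌉₊ : ℝ) ≤ 11 * (n : ℝ) ^ (1 / 4 : ℝ) := by
      rw [hs]
      linarith
    obtain ⟨V, _, I, h1, h2, h3⟩ := exists_needsTime_sqrt_add_diam mode (D := ⌈10 * s⌉₊) A hκ hB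
      (by rw [hs]; exact Nat.le_ceil _)
      (by
        have h : (⌈10 * s⌉₊ + 1 : ℝ) ≤ n := by
          rw [← hs4]
          have : 27 ≤ s ^ 3 := by
            have := pow_le_pow_left₀ (by norm_num) hs3 3
            norm_num at this
            exact this
          nlinarith
        exact_mod_cast h)
      fun V _ I hI hd => hA V I hI (by rw [hd]; exact hdiam)
    refine ⟨V, _, I, h1, by rw [h2]; exact hdiam, h3.mono ?_⟩
    have : (0 : ℝ) ≤ (⌈10 * s⌉₊ : ℝ) := Nat.cast_nonneg _
    linarith
  · intro V _ N S κ A hconn hD _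
    exact exists_needsTime_diam N S κ A hconn hD
  · intro mode κ n D B A hκ hB hD hDn hA
    exact exists_needsTime_sqrt_add_diam mode A hκ hB hD hDn hA
  · have hK : 0 < max K 1 := lt_max_of_lt_right one_pos
    refine ⟨1 / 128 / max K 1, by positivity, ?_⟩
    intro mode κ n D B A hκ hB hD hDn hA
    have hn1 : (1 : ℝ) ≤ n := by exact_mod_cast (by omega : 1 ≤ n)
    have hD10 : (10 : ℝ) ≤ D := by
      have := Real.one_le_rpow hn1 (by norm_num : (0 : ℝ) ≤ 1 / 4)
      linarith
    have hlog : 1 ≤ Real.log n := by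
      rw [Real.le_log_iff_exp_le (by linarith)]
      have h1 : (D + 1 : ℝ) ≤ n := by exact_mod_cast hDn
      have h2 := Real.exp_one_lt_d9
      linarith
    obtain ⟨V, _, I, h1, h2, h3⟩ := exists_needsTime_sqrt_add_diam mode (B := max B 1) A hκ
      (le_max_right _ _) hD hDn fun V _ I hI hd => (hA V I hI hd).mono (le_max_left _ _)
    refine ⟨V, _, I, h1, h2, h3.mono ?_⟩
    have hBK : ((max B 1 : ℕ) : ℝ) ≤ max K 1 * Real.log n := by
      push_cast
      refine max_le (hB.trans ?_) ?_
      · exact mul_le_mul_of_nonneg_right (le_max_left _ _) (by linarith)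
      · nlinarith [le_max_right K 1]
    have hB0 : (0 : ℝ) < (max B 1 : ℕ) := by exact_mod_cast lt_max_of_lt_right one_pos
    have hKl : 1 ≤ max K 1 * Real.log n := by nlinarith [le_max_right K 1]
    have e1 : √n / (max K 1 * Real.log n) ≤ √n / (max B 1 : ℕ) :=
      div_le_div_of_nonneg_left (Real.sqrt_nonneg _) hB0 hBK
    have e2 : (D : ℝ) / (max K 1 * Real.log n) ≤ D := div_le_self (Nat.cast_nonneg D) hKl
    calc 1 / 128 / max K 1 * ((√n + D) / Real.log n)
        = 1 / 128 * (√n / (max K 1 * Real.log n) + D / (max K 1 * Real.log n)) := by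
          field_simp
      _ ≤ 1 / 128 * (√n / (max B 1 : ℕ) + D) := by linarith
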